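/- A *constraint* of arity $k$ is a Boolean function $C\colon\{0,1\}^k\to\{0,1\}$. It is *affine* if it is equivalent to an XOR-CNF formula, i.e. a conjunction of clauses each of which is the exclusive or of a list of literals (the empty clause being false). A finite set $\mathcal C$ of constraints is affine if every $C\in\mathcal C$ is affine. For a finite set $X$ of variables, a *constraint application of $\mathcal C$ with constants over $X$* is an expression $C(a_1,\dots,a_k)$, where $C\in\mathcal C$ has arity $k$ and each $a_i$ is an element of $X$ or a constant $0$ or $1$ (the $a_i$ need not be distinct, and not every variable of $X$ has to occur); it is viewed as a Boolean function of the variables in $X$. Two finite sets $S,U$ of such applications are *equivalent* if they are satisfied by the same assignments $X\to\{0,1\}$, and *isomorphic* if there is a permutation $\pi$ of $X$ such that $\pi(S)$, obtained from $S$ by simultaneously replacing every variable $x$ by $\pi(x)$, is equivalent to $U$. $\mathrm{ISO}_c(\mathcal C)$ is the problem of deciding, given a finite set $X$ and two finite sets $S,U$ of constraint applications of $\mathcal C$ with constants over $X$, whether $S$ and $U$ are isomorphic. $\mathrm{GI}$ is the problem of deciding whether two given finite undirected graphs without self-loops are isomorphic. **Theorem.** Let $\mathcal C$ be a finite set of constraints.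 If $\mathcal C$ is not affine, then $\mathrm{GI}$ is polynomial-time many-one reducible to $\mathrm{ISO}_c(\mathcal C)$: there is a function $f$, computable by a Turing machine in time polynomial in the length of the (standard binary) code of its input, that maps every pair $(G,H)$ of finite graphs to an instance $f(G,H)=(X,S,U)$ of $\mathrm{ISO}_c(\mathcal C)$ such that $G$ and $H$ are isomorphic if and only if $S$ and $U$ are isomorphic. -/

import Mathlib

namespace BoolIso

/-! Binary codes -/

/-- A self-delimiting binary code: a code word can be read off the front of any string in exactly
one way. -/
def SelfDelimiting {α : Type} (e : α → List Bool) : Prop :=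
  ∀ a b s t, e a ++ s = e b ++ t → a = b ∧ s = t

theorem SelfDelimiting.injective {α : Type} {e : α → List Bool} (h : SelfDelimiting e) :
    Function.Injective e := fun a b hab => (h a b [] [] (by rw [hab])).1

/-- The unary code `1 … 1 0` of a natural number. -/
def encodeNat (n : ℕ) : List Bool := List.replicate n true ++ [false]

theorem encodeNat_selfDelimiting : SelfDelimiting encodeNat := by
  intro a
  induction a with
  | zero =>
    intro b s t h
    cases b with
    | zero => simpa [encodeNat] using h
    | succ b => simp [encodeNat, List.replicate_succ] at h
  | succ a ih =>
    intro b s t h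
    cases b with
    | zero => simp [encodeNat, List.replicate_succ] at h
    | succ b =>
      have h' : encodeNat a ++ s = encodeNat b ++ t := by
        simpa [encodeNat, List.replicate_succ] using h
      obtain ⟨rfl, rfl⟩ := ih b s t h'
      exact ⟨rfl, rfl⟩

/-- The code of a list: each entry is preceded by a bit `1`, and a bit `0` ends the list. -/
def encodeList {α : Type} (e : α → List Bool) (l : List α) : List Bool :=
  l.flatMap (fun a => true :: e a) ++ [false]

theorem encodeList_selfDelimiting {α : Type} {e : α → List Bool} (he : SelfDelimiting e) :
    SelfDelimiting (encodeList e) := by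
  intro a
  induction a with
  | nil =>
    intro b s t h
    cases b with
    | nil => simpa [encodeList] using h
    | cons y b => simp [encodeList] at h
  | cons x a ih =>
    intro b s t h
    cases b with
    | nil => simp [encodeList] at h
    | cons y b =>
      have h' : e x ++ (encodeList e a ++ s) = e y ++ (encodeList e b ++ t) := by
        simpa [encodeList] using h
      obtain ⟨rfl, h''⟩ := he _ _ _ _ h'
      obtain ⟨rfl, rfl⟩ := ih b s t h''
      exact ⟨rfl, rfl⟩

/-- The code of a tuple of known length: the codes of its entries, one after the other. -/
def encodeTuple {α : Type} (e : α → List Bool) {k : ℕ} (v : Fin k → α) : List Bool :=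
  (List.ofFn v).flatMap e

theorem encodeTuple_selfDelimiting {α : Type} {e : α → List Bool} (he : SelfDelimiting e)
    (k : ℕ) : SelfDelimiting (encodeTuple e (k := k)) := by
  induction k with
  | zero =>
    intro a b s t h
    exact ⟨Subsingleton.elim _ _, by simpa [encodeTuple] using h⟩
  | succ k ih =>
    intro a b s t h
    have h' : e (a 0) ++ (encodeTuple e (fun i : Fin k => a i.succ) ++ s)
        = e (b 0) ++ (encodeTuple e (fun i : Fin k => b i.succ) ++ t) := by
      simpa [encodeTuple, List.ofFn_succ] using h
    obtain ⟨h0, h1⟩ := he _ _ _ _ h'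
    obtain ⟨h2, h3⟩ := ih _ _ _ _ h1
    refine ⟨funext fun i => ?_, h3⟩
    refine Fin.cases h0 (fun j => ?_) i
    exact congrFun h2 j

/-- The code of a single bit. -/
def encodeBit (b : Bool) : List Bool := [b]

theorem encodeBit_selfDelimiting : SelfDelimiting encodeBit := by
  intro a b s t h
  simpa [encodeBit] using h

/-! Decision problems and reductions -/

/-- A decision problem: a type of instances, an injective coding of the instances as binary
strings, and the set of yes-instances. -/
structure DecisionProblem where
  Instance : Type
  encode : Instance → List Bool
  encode_injective : Function.Injective encode
  Yes : Instance → Prop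

/-- Polynomial-time many-one reducibility: a function that maps instances of `A` to instances of
`B`, preserves the answer, and is computed on the codes by a (multi-tape) Turing machine within a
number of steps that is polynomial in the length of the code. -/
def PolyTimeManyOneReducible (A B : DecisionProblem) : Prop :=
  ∃ f : A.Instance → B.Instance,
    Nonempty (Turing.TM2ComputableInPolyTime A.encode B.encode f) ∧
      ∀ x, A.Yes x ↔ B.Yes (f x)

/-! Graph isomorphism -/

/-- A finite graph (undirected, without self-loops) with vertex set `{0, …, order - 1}`. -/
structure Graph where
  order : ℕ
  graph : SimpleGraph (Fin order)

open Classical in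
/-- The code of a graph: its order in unary, then the rows of its adjacency matrix. -/
noncomputable def Graph.encode (G : Graph) : List Bool :=
  encodeNat G.order ++
    encodeTuple (fun row : Fin G.order → Bool => encodeTuple encodeBit row)
      (fun v w => decide (G.graph.Adj v w))

theorem Graph.encode_selfDelimiting : SelfDelimiting Graph.encode := by
  rintro ⟨n, G⟩ ⟨m, H⟩ s t h
  simp only [Graph.encode, List.append_assoc] at h
  obtain ⟨rfl, h1⟩ := encodeNat_selfDelimiting _ _ _ _ h
  obtain ⟨h2, rfl⟩ := encodeTuple_selfDelimiting
    (encodeTuple_selfDelimiting encodeBit_selfDelimiting n) n _ _ _ _ h1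
  refine ⟨?_, rfl⟩
  congr 1
  ext v w
  simpa using congrFun (congrFun h2 v) w

/-- The graph isomorphism problem: given two graphs, are they isomorphic? -/
noncomputable def GI : DecisionProblem where
  Instance := Graph × Graph
  encode := fun p => p.1.encode ++ p.2.encode
  encode_injective := by
    rintro ⟨G, H⟩ ⟨G', H'⟩ h
    obtain ⟨rfl, h1⟩ := Graph.encode_selfDelimiting _ _ _ _ h
    obtain rfl := Graph.encode_selfDelimiting.injective h1
    rfl
  Yes := fun p => Nonempty (p.1.graph ≃g p.2.graph)

/-! Constraints -/

/-- A Boolean constraint: a Boolean function of some arity. -/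
structure Constraint where
  arity : ℕ
  toFun : (Fin arity → Bool) → Bool

/-- A literal over `k` variables: `(i, true)` is the variable `i`, `(i, false)` its negation. -/
abbrev Literal (k : ℕ) : Type := Fin k × Bool

/-- The value of a literal under an assignment. -/
def Literal.eval {k : ℕ} (l : Literal k) (a : Fin k → Bool) : Bool :=
  if l.2 then a l.1 else !(a l.1)

/-- The value of an XOR-clause, the exclusive or of the literals in a list. The empty XOR-clause is
false. -/
def evalXorClause {k : ℕ} (c : List (Literal k)) (a : Fin k → Bool) : Bool :=
  c.foldr (fun l b => xor (l.eval a) b) false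

/-- The value of an XOR-CNF formula, a conjunction of XOR-clauses. -/
def evalXorCNF {k : ℕ} (φ : List (List (Literal k))) (a : Fin k → Bool) : Bool :=
  φ.all (fun c => evalXorClause c a)

/-- A constraint is affine if it is equivalent to an XOR-CNF formula. -/
def Constraint.IsAffine (C : Constraint) : Prop :=
  ∃ φ : List (List (Literal C.arity)), ∀ a, C.toFun a = evalXorCNF φ a

/-- A finite set of constraints is affine if every constraint in it is affine. -/
def IsAffine (𝒞 : Finset Constraint) : Prop := ∀ C ∈ 𝒞, C.IsAffine

/-- The code of a constraint: its arity in unary, then its truth table. -/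
def Constraint.encode (C : Constraint) : List Bool :=
  encodeNat C.arity ++
    encodeTuple encodeBit (fun i : Fin (2 ^ C.arity) => C.toFun (fun j => Nat.testBit i j))

theorem Constraint.encode_selfDelimiting : SelfDelimiting Constraint.encode := by
  rintro ⟨k, f⟩ ⟨m, g⟩ s t h
  simp only [Constraint.encode, List.append_assoc] at h
  obtain ⟨rfl, h1⟩ := encodeNat_selfDelimiting _ _ _ _ h
  obtain ⟨h2, rfl⟩ := encodeTuple_selfDelimiting encodeBit_selfDelimiting _ _ _ _ _ h1
  refine ⟨?_, rfl⟩
  congr 1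
  funext a
  have h3 := congrFun h2 ⟨Nat.ofBits a, Nat.ofBits_lt_two_pow a⟩
  have h4 : (fun j : Fin k => Nat.testBit (Nat.ofBits a) j) = a := by
    funext j
    simp
  simpa only [h4] using h3

/-! Constraint applications with constants -/

/-- An argument of a constraint application with constants over variables `{0, …, n - 1}`: a
variable or a constant. -/
inductive Arg (n : ℕ) : Type
  | var (i : Fin n)
  | const (b : Bool)

namespace Arg

variable {n : ℕ}

/-- The value of an argument under an assignment. -/
def eval (I : Fin n → Bool) : Arg n → Bool
  | var i => I i
  | const b => b

/-- Renaming of the variables. -/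
def rename (π : Equiv.Perm (Fin n)) : Arg n → Arg n
  | var i => var (π i)
  | const b => const b

/-- The code of an argument. -/
def encode : Arg n → List Bool
  | var i => true :: encodeNat i
  | const b => [false, b]

theorem encode_selfDelimiting : SelfDelimiting (encode (n := n)) := by
  rintro (i | b) (j | c) s t h
  · have h' : encodeNat i ++ s = encodeNat j ++ t := by simpa [encode] using h
    obtain ⟨h1, rfl⟩ := encodeNat_selfDelimiting _ _ _ _ h'
    exact ⟨congrArg var (Fin.ext h1), rfl⟩
  · simp [encode] at h
  · simp [encode] at h
  · simpa [encode] using h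

end Arg

/-- A constraint application with constants of the set `𝒞` over variables `{0, …, n - 1}`. The
arguments need not be distinct. -/
structure Application (𝒞 : Finset Constraint) (n : ℕ) where
  constraint : Constraint
  mem : constraint ∈ 𝒞
  args : Fin constraint.arity → Arg n

namespace Application

variable {𝒞 : Finset Constraint} {n : ℕ}

/-- The value of a constraint application under an assignment. -/
def eval (A : Application 𝒞 n) (I : Fin n → Bool) : Bool :=
  A.constraint.toFun (fun j => (A.args j).eval I)

/-- The constraint application in which every variable `x` is replaced by `π x`. -/
def rename (π : Equiv.Perm (Fin n)) (A : Application 𝒞 n) : Application 𝒞 n where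
  constraint := A.constraint
  mem := A.mem
  args := fun j => (A.args j).rename π

/-- The code of a constraint application: the constraint, then the arguments. -/
def encode (A : Application 𝒞 n) : List Bool :=
  A.constraint.encode ++ encodeTuple Arg.encode A.args

theorem encode_selfDelimiting : SelfDelimiting (encode (𝒞 := 𝒞) (n := n)) := by
  rintro ⟨C, hC, v⟩ ⟨D, hD, w⟩ s t h
  simp only [encode, List.append_assoc] at h
  obtain ⟨rfl, h1⟩ := Constraint.encode_selfDelimiting _ _ _ _ h
  obtain ⟨rfl, rfl⟩ := encodeTuple_selfDelimiting Arg.encode_selfDelimiting _ _ _ _ _ h1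
  exact ⟨rfl, rfl⟩

end Application

/-- An assignment satisfies a set of constraint applications, given as a list, if it satisfies
every one of them. -/
def Satisfies {𝒞 : Finset Constraint} {n : ℕ} (I : Fin n → Bool)
    (S : List (Application 𝒞 n)) : Prop :=
  ∀ A ∈ S, A.eval I = true

/-- Logical equivalence of two sets of constraint applications over the same variables. -/
def Equivalent {𝒞 : Finset Constraint} {n : ℕ} (S U : List (Application 𝒞 n)) : Prop :=
  ∀ I : Fin n → Bool, Satisfies I S ↔ Satisfies I U

/-- Two sets `S` and `U` of constraint applications are isomorphic if `π(S)` is equivalent to `U`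
for some permutation `π` of the variables. -/
def Isomorphic {𝒞 : Finset Constraint} {n : ℕ} (S U : List (Application 𝒞 n)) : Prop :=
  ∃ π : Equiv.Perm (Fin n), Equivalent (S.map (Application.rename π)) U

/-- An instance of the constraint isomorphism problem with constants: a finite set of variables
`{0, …, numVars - 1}` and two finite sets of constraint applications over these variables, given
as lists. Not every variable has to occur. -/
structure IsoInstance (𝒞 : Finset Constraint) where
  numVars : ℕ
  S : List (Application 𝒞 numVars)
  U : List (Application 𝒞 numVars)

/-- The code of an instance. The number of variables is given in unary, so that the length of the
code is at least the number of variables, as it is when the variables are listed. -/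
def IsoInstance.encode {𝒞 : Finset Constraint} (x : IsoInstance 𝒞) : List Bool :=
  encodeNat x.numVars ++ (encodeList Application.encode x.S ++ encodeList Application.encode x.U)

/-- The constraint isomorphism problem for constraint applications of `𝒞` with constants. -/
def ISOc (𝒞 : Finset Constraint) : DecisionProblem where
  Instance := IsoInstance 𝒞
  encode := IsoInstance.encode
  encode_injective := by
    rintro ⟨n, S, U⟩ ⟨m, S', U'⟩ h
    simp only [IsoInstance.encode] at h
    obtain ⟨rfl, h1⟩ := encodeNat_selfDelimiting _ _ _ _ h
    obtain ⟨rfl, h2⟩ := encodeList_selfDelimiting Application.encode_selfDelimiting _ _ _ _ h1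
    obtain rfl := (encodeList_selfDelimiting Application.encode_selfDelimiting).injective h2
    rfl
  Yes := fun x => Isomorphic x.S x.U

end BoolIso

/-!
# Graph isomorphism reduces to constraint isomorphism for non-affine constraints

**A gadget.** A constraint whose set of satisfying assignments is closed under the ternary sum
`x + y + z` modulo 2 is affine, because that set is then a coset of a subspace, which is cut out by
linear equations (`Constraint.isAffine_of_add3`). So a non-affine constraint `C` has three
satisfying assignments whose sum falsifies `C`. If these are chosen so that the face of the cube
spanned by them is minimal, then they are the only satisfying assignments on this face
(`exists_threePointFace`). Substituting constants for the coordinates at which the three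
assignments are equal, one gets a constraint on the other coordinates, and each of these belongs to
the assignment that is the odd one out there. Reading the coordinates of the first kind as copies of
a truth value `α`, up to negation, and those of the second kind as copies of `β`, the constraint
says that `α` and `β` are not both true; the coordinates of the third kind, if there are any, are
then copies of the truth value "neither `α` nor `β`".

**The constraints of a graph.** Every vertex `i` is represented by an object, and every ordered pair
`(i, j)` of vertices, adjacent or not, has `4 * k + 2` pairing objects, where `k` is the arity of
`C`; gadgets say that `i` and a pairing object of `(i, j)` are not both true. If `i` and `j` are
adjacent then the first of these pairing objects and `j` are not both true either. An auxiliary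
object takes up the coordinates of the third kind of this last gadget. Each object has `k`
variables.

**Recovering the graph.** Call two variables dependent if some combination of values for them occurs
in no solution; this notion depends only on the set of solutions. A variable that does not belong to
a vertex depends on at most `4 * k` variables, or only on itself, while a variable that occurs in
the constraints and belongs to a vertex depends on more than that (`highlyDependent_iff`). Variables
of vertices are dependent exactly if they belong to the same vertex (`dependent_vertex_iff`), and
two vertices are adjacent exactly if some variable that belongs to no vertex depends on both
(`exists_dependent_iff_adj`). So equal sets of solutions come from isomorphic graphs
(`nonempty_iso_of_solutions_eq`), also if the graphs are not known to have the same order: the set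
of variables of the instance is large enough for either graph. Conversely, an isomorphism of graphs
induces an injection between the variables that occur, and it extends to a permutation of all
variables (`reduction_correct`).

**Computing the reduction.** Structured programs on finitely many stacks of bits are compiled into
Turing machines (`StackProgram.computableInPolyTime`). The variables are numbered such that all
numbers occurring in the gadgets of the pair `(i, j)` are sums of one of the three addresses
`k * i`, `k * j` and that of the first pairing object, and an offset bounded in terms of `k`. The
addresses are kept in unary on stacks and increased by constants in two nested loops over the rows
and columns of the adjacency matrix, so that each gadget is printed by copying stacks
(`reductionProgram_run`).
-/

namespace BoolIso

/-! ### Structured programs over Boolean stacks -/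

/-- Structured programs that manipulate finitely many stacks of bits, indexed by `K`.
* `push k b` pushes `b` on stack `k`;
* `ifPop k p q` pops stack `k` and runs `p` if the popped bit is `1`, and `q` otherwise;
* `loop k once p q` pops stack `k` repeatedly. It ends if the stack was empty, runs `p` and
  continues if the bit is `1`, and runs `q` if the bit is `0`, after which it ends if `once` is
  set and continues otherwise. -/
inductive StackProgram (K : Type) : Type
  | skip : StackProgram K
  | push (k : K) (b : Bool) : StackProgram K
  | seq (p q : StackProgram K) : StackProgram K
  | ifPop (k : K) (p q : StackProgram K) : StackProgram K
  | loop (k : K) (once : Bool) (p q : StackProgram K) : StackProgram K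

namespace StackProgram

open Turing Function

variable {K : Type}

/-- The labels of the stack machine that executes a program. -/
@[reducible] def Label : StackProgram K → Type
  | skip => Unit
  | push _ _ => Unit
  | seq p q => p.Label ⊕ q.Label
  | ifPop _ p q => Option (p.Label ⊕ q.Label)
  | loop _ _ p q => Option (p.Label ⊕ q.Label)

/-- A program has finitely many labels. -/
@[reducible] def labelFintype : (p : StackProgram K) → Fintype p.Label
  | skip => inferInstanceAs (Fintype Unit)
  | push _ _ => inferInstanceAs (Fintype Unit)
  | seq p q =>
    letI := p.labelFintype
    letI := q.labelFintype
    inferInstanceAs (Fintype (p.Label ⊕ q.Label))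
  | ifPop _ p q =>
    letI := p.labelFintype
    letI := q.labelFintype
    inferInstanceAs (Fintype (Option (p.Label ⊕ q.Label)))
  | loop _ _ p q =>
    letI := p.labelFintype
    letI := q.labelFintype
    inferInstanceAs (Fintype (Option (p.Label ⊕ q.Label)))

/-- The label at which the execution of a program starts. -/
def entry : (p : StackProgram K) → p.Label
  | skip => ()
  | push _ _ => ()
  | seq p _ => Sum.inl p.entry
  | ifPop _ _ _ => none
  | loop _ _ _ _ => none

/-- The code of a program, as part of a machine with labels `Λ` that contains the labels of the
program via `emb` and is in control at label `exit` when the program ends. The internal state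
holds the bit that was popped last. -/
def code {Λ : Type} : (p : StackProgram K) → (exit : Λ) → (emb : p.Label → Λ) → p.Label →
    TM2.Stmt (fun _ : K => Bool) Λ (Option Bool)
  | skip, e, _, _ => .goto fun _ => e
  | push k b, e, _, _ => .push k (fun _ => b) (.goto fun _ => e)
  | seq p q, _, emb, .inl l => p.code (emb (.inr q.entry)) (fun l => emb (.inl l)) l
  | seq _ q, e, emb, .inr l => q.code e (fun l => emb (.inr l)) l
  | ifPop k p q, _, emb, none => .pop k (fun _ o => o) (.goto fun o =>
      if o = some true then emb (some (.inl p.entry)) else emb (some (.inr q.entry)))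
  | ifPop _ p _, e, emb, some (.inl l) => p.code e (fun l => emb (some (.inl l))) l
  | ifPop _ _ q, e, emb, some (.inr l) => q.code e (fun l => emb (some (.inr l))) l
  | loop k _ p q, e, emb, none => .pop k (fun _ o => o) (.goto fun o =>
      match o with
      | none => e
      | some true => emb (some (.inl p.entry))
      | some false => emb (some (.inr q.entry)))
  | loop _ _ p _, _, emb, some (.inl l) => p.code (emb none) (fun l => emb (some (.inl l))) l
  | loop _ once _ q, e, emb, some (.inr l) =>
    q.code (if once then e else emb none) (fun l => emb (some (.inr l))) l

variable [DecidableEq K]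

/-- `Run p S S' t`: started with stack contents `S`, the program `p` ends with stack contents `S'`
after `t` steps. -/
inductive Run : StackProgram K → (K → List Bool) → (K → List Bool) → ℕ → Prop
  | skip (S) : Run skip S S 1
  | push (k b S) : Run (push k b) S (update S k (b :: S k)) 1
  | seq {p q S S₁ S₂ t₁ t₂} : Run p S S₁ t₁ → Run q S₁ S₂ t₂ → Run (seq p q) S S₂ (t₁ + t₂)
  | ifPop_true {k p q S S' r t} : S k = true :: r → Run p (update S k r) S' t →
      Run (ifPop k p q) S S' (t + 1)
  | ifPop_false {k p q S S' r t} : S k = false :: r → Run q (update S k r) S' t →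
      Run (ifPop k p q) S S' (t + 1)
  | loop_nil {k once p q S} : S k = [] → Run (loop k once p q) S S 1
  | loop_true {k once p q S S₁ S₂ r t₁ t₂} : S k = true :: r → Run p (update S k r) S₁ t₁ →
      Run (loop k once p q) S₁ S₂ t₂ → Run (loop k once p q) S S₂ (t₂ + (t₁ + 1))
  | loop_once {k p q S S' r t} : S k = false :: r → Run q (update S k r) S' t →
      Run (loop k true p q) S S' (t + 1)
  | loop_false {k p q S S₁ S₂ r t₁ t₂} : S k = false :: r → Run q (update S k r) S₁ t₁ →
      Run (loop k false p q) S₁ S₂ t₂ → Run (loop k false p q) S S₂ (t₂ + (t₁ + 1))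

/-- A machine that contains the code of a program executes the program. -/
theorem Run.iterate_step {p : StackProgram K} {S S' : K → List Bool} {t : ℕ} (h : Run p S S' t)
    {Λ : Type} (M : Λ → TM2.Stmt (fun _ : K => Bool) Λ (Option Bool)) (exit : Λ)
    (emb : p.Label → Λ) (hM : ∀ l, M (emb l) = p.code exit emb l) (v : Option Bool) :
    ∃ v', (flip bind (TM2.step M))^[t] (some ⟨some (emb p.entry), v, S⟩) =
      some ⟨some exit, v', S'⟩ := by
  induction h generalizing exit v with
  | skip S =>
    exact ⟨v, by simp [flip, hM, code, TM2.step]⟩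
  | push k b S =>
    exact ⟨v, by simp [flip, hM, code, TM2.step]⟩
  | @seq p q S S₁ S₂ t₁ t₂ _ _ ih₁ ih₂ =>
    obtain ⟨v₁, h₁⟩ := ih₁ (emb (.inr q.entry)) (fun l => emb (.inl l))
      (fun l => by rw [hM, code]) v
    obtain ⟨v₂, h₂⟩ := ih₂ exit (fun l => emb (.inr l)) (fun l => by rw [hM, code]) v₁
    refine ⟨v₂, ?_⟩
    rw [Nat.add_comm, iterate_add_apply, entry, h₁, h₂]
  | @ifPop_true k p q S S' r t hS _ ih =>
    obtain ⟨v', h'⟩ := ih exit (fun l => emb (some (.inl l))) (fun l => by rw [hM, code])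
      (some true)
    refine ⟨v', ?_⟩
    rw [iterate_add_apply, ← h']
    simp [flip, hM, code, TM2.step, entry, hS]
  | @ifPop_false k p q S S' r t hS _ ih =>
    obtain ⟨v', h'⟩ := ih exit (fun l => emb (some (.inr l))) (fun l => by rw [hM, code])
      (some false)
    refine ⟨v', ?_⟩
    rw [iterate_add_apply, ← h']
    simp [flip, hM, code, TM2.step, entry, hS]
  | @loop_nil k once p q S hS =>
    have hu : update S k [] = S := by rw [← hS, update_eq_self]
    exact ⟨none, by simp [flip, hM, code, TM2.step, entry, hS, hu]⟩
  | @loop_true k once p q S S₁ S₂ r t₁ t₂ hS _ _ ih₁ ih₂ =>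
    obtain ⟨v₁, h₁⟩ := ih₁ (emb none) (fun l => emb (some (.inl l))) (fun l => by rw [hM, code])
      (some true)
    obtain ⟨v₂, h₂⟩ := ih₂ exit emb hM v₁
    refine ⟨v₂, ?_⟩
    rw [iterate_add_apply, iterate_add_apply, ← h₂, entry, ← h₁]
    simp [flip, hM, code, TM2.step, hS]
  | @loop_once k p q S S' r t hS _ ih =>
    obtain ⟨v', h'⟩ := ih exit (fun l => emb (some (.inr l)))
      (fun l => by rw [hM, code, if_pos rfl]) (some false)
    refine ⟨v', ?_⟩
    rw [iterate_add_apply, ← h']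
    simp [flip, hM, code, TM2.step, entry, hS]
  | @loop_false k p q S S₁ S₂ r t₁ t₂ hS _ _ ih₁ ih₂ =>
    obtain ⟨v₁, h₁⟩ := ih₁ (emb none) (fun l => emb (some (.inr l)))
      (fun l => by rw [hM, code, if_neg (by simp)]) (some false)
    obtain ⟨v₂, h₂⟩ := ih₂ exit emb hM v₁
    refine ⟨v₂, ?_⟩
    rw [iterate_add_apply, iterate_add_apply, ← h₂, entry, ← h₁]
    simp [flip, hM, code, TM2.step, hS]

/-- The Turing machine that executes a program, with input stack `k₀` and output stack `k₁`. -/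
def machine [Fintype K] (p : StackProgram K) (k₀ k₁ : K) : FinTM2 where
  K := K
  k₀ := k₀
  k₁ := k₁
  Γ := fun _ => Bool
  Λ := Option p.Label
  main := some p.entry
  ΛFin := letI := p.labelFintype; inferInstance
  σ := Option Bool
  initialState := none
  Γk₀Fin := inferInstanceAs (Fintype Bool)
  m
    | none => .load (fun _ => none) .halt
    | some l => p.code none some l

/-- The stack contents in which stack `k` contains `l` and all other stacks are empty. -/
def only (k : K) (l : List Bool) : K → List Bool := update (fun _ => []) k l

theorem dite_eq_only (k k₀ : K) (l : List Bool) (d : Decidable (k = k₀))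
    (g : k = k₀ → List Bool) (hg : ∀ h, g h = l) :
    @dite _ (k = k₀) d g (fun _ => []) = only k₀ l k := by
  by_cases hk : k = k₀
  · rw [dif_pos hk, hg, hk, only, update_self]
  · rw [dif_neg hk, only, update_of_ne hk]

/-- A function that a program computes on the codes within a polynomial number of steps is
computable in polynomial time. -/
theorem computableInPolyTime [Fintype K] {α β : Type} (ea : α → List Bool) (eb : β → List Bool)
    (f : α → β) (p : StackProgram K) (k₀ k₁ : K) (time : Polynomial ℕ)
    (h : ∀ a, ∃ t, t + 1 ≤ time.eval (ea a).length ∧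
      Run p (only k₀ (ea a)) (only k₁ (eb (f a))) t) :
    Nonempty (TM2ComputableInPolyTime ea eb f) := by
  choose t ht hrun using h
  refine ⟨⟨⟨machine p k₀ k₁, Equiv.refl _, Equiv.refl _⟩, time, fun a => ⟨⟨t a + 1, ?_⟩, ht a⟩⟩⟩
  obtain ⟨v, hv⟩ := (hrun a).iterate_step (machine p k₀ k₁).m none some (fun _ => rfl) none
  have h0 : initList (machine p k₀ k₁) (List.map (Equiv.refl Bool).invFun (ea a)) =
      ⟨some (some p.entry), none, only k₀ (ea a)⟩ := by
    unfold initList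
    congr 1
    funext (k : K)
    exact dite_eq_only k k₀ _ _ _ fun h => by subst h; exact List.map_id _
  have h1 : haltList (machine p k₀ k₁) (List.map (Equiv.refl Bool).invFun (eb (f a))) =
      ⟨none, none, only k₁ (eb (f a))⟩ := by
    unfold haltList
    congr 1
    funext (k : K)
    exact dite_eq_only k k₁ _ _ _ fun h => by subst h; exact List.map_id _
  simp only [Option.map_some]
  erw [h0, h1]
  rw [iterate_succ_apply']
  erw [hv]
  rfl

/-- A program pushes at most one bit per step. -/
theorem Run.length_le [Fintype K] {p : StackProgram K} {S S' : K → List Bool} {t : ℕ}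
    (h : Run p S S' t) : ∑ k, (S' k).length ≤ ∑ k, (S k).length + t := by
  have key : ∀ (S : K → List Bool) (k : K) (r : List Bool), r.length ≤ (S k).length + 1 →
      ∑ i, (update S k r i).length ≤ ∑ i, (S i).length + 1 := by
    intro S k r hr
    rw [← Finset.add_sum_erase _ _ (Finset.mem_univ k),
      ← Finset.add_sum_erase (a := k) _ (fun i => (S i).length) (Finset.mem_univ k)]
    have : ∑ i ∈ Finset.univ.erase k, (update S k r i).length =
        ∑ i ∈ Finset.univ.erase k, (S i).length :=
      Finset.sum_congr rfl fun i hi => by rw [update_of_ne (Finset.ne_of_mem_erase hi)]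
    simp only [update_self]
    omega
  induction h with
  | skip S => omega
  | push k b S => exact key S k _ (by simp)
  | seq _ _ ih₁ ih₂ => omega
  | @ifPop_true k p q S S' r t hS _ ih =>
    have := key S k r (by simp [hS]; omega)
    omega
  | @ifPop_false k p q S S' r t hS _ ih =>
    have := key S k r (by simp [hS]; omega)
    omega
  | loop_nil => omega
  | @loop_true k once p q S S₁ S₂ r t₁ t₂ hS _ _ ih₁ ih₂ =>
    have := key S k r (by simp [hS]; omega)
    omega
  | @loop_once k p q S S' r t hS _ ih =>
    have := key S k r (by simp [hS]; omega)
    omega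
  | @loop_false k p q S S₁ S₂ r t₁ t₂ hS _ _ ih₁ ih₂ =>
    have := key S k r (by simp [hS]; omega)
    omega

end StackProgram

end BoolIso

namespace BoolIso

/-! ### Constraints that are closed under ternary sums are affine -/

/-- The sum modulo 2 of three assignments. -/
def add3 {k : ℕ} (u v w : Fin k → Bool) : Fin k → Bool := fun i => xor (u i) (xor (v i) (w i))

/-- A bit as an element of `ZMod 2`. -/
def bitCast (b : Bool) : ZMod 2 := if b then 1 else 0

theorem bitCast_xor (a b : Bool) : bitCast (xor a b) = bitCast a + bitCast b := by
  cases a <;> cases b <;> decide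

theorem bitCast_injective : Function.Injective bitCast := by decide

theorem bitCast_evalXorClause {k : ℕ} (g : Fin k → ZMod 2) (v x : Fin k → Bool)
    (l : List (Fin k)) :
    bitCast (evalXorClause ((l.filter fun i => g i = 1).map fun i => (i, !(v i))) x) =
      (l.map fun i => (bitCast (x i) + bitCast (v i)) * g i).sum := by
  induction l with
  | nil => rfl
  | cons i l ih =>
    have hlit : bitCast (Literal.eval (i, !(v i)) x) = bitCast (x i) + bitCast (v i) := by
      simp only [Literal.eval]
      cases x i <;> cases v i <;> decide
    by_cases hg : g i = 1
    · simp only [List.filter_cons, hg, decide_true, if_true, List.map_cons, List.sum_cons, ← ih]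
      rw [evalXorClause, List.foldr_cons, bitCast_xor, hlit, mul_one]
      rfl
    · have h0 : g i = 0 := by
        revert hg
        generalize g i = a
        revert a
        decide
      simp [h0, ih]

/-- An assignment that falsifies a constraint closed under ternary sums is separated from the
satisfying assignments by an XOR-clause. -/
theorem exists_separating_xorClause {k : ℕ} (f : (Fin k → Bool) → Bool)
    (hf : ∀ u v w, f u = true → f v = true → f w = true → f (add3 u v w) = true)
    {v a : Fin k → Bool} (hv : f v = true) (ha : f a = false) :
    ∃ c : List (Literal k), (∀ x, f x = true → evalXorClause c x = true) ∧
      evalXorClause c a = false := by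
  classical
  have hne : a ≠ v := by
    rintro rfl
    simp [hv] at ha
  obtain ⟨i₀, -⟩ := Function.ne_iff.mp hne
  -- the direction space of the affine space of satisfying assignments
  let vec : (Fin k → Bool) → Fin k → ZMod 2 := fun x i => bitCast (x i)
  have hvec : Function.Injective vec := fun x y h =>
    funext fun i => bitCast_injective (congrFun h i)
  have hadd : ∀ x y z, vec (add3 x y z) = vec x + (vec y + vec z) := fun x y z => by
    funext i
    simp [vec, add3, bitCast_xor]
  have hself : ∀ x : Fin k → ZMod 2, x + x = 0 := fun x => by
    funext i
    exact CharTwo.add_self_eq_zero (x i)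
  let W : Submodule (ZMod 2) (Fin k → ZMod 2) :=
    { carrier := {x | ∃ y, f y = true ∧ x = vec y + vec v}
      zero_mem' := ⟨v, hv, (hself _).symm⟩
      add_mem' := by
        rintro _ _ ⟨y, hy, rfl⟩ ⟨z, hz, rfl⟩
        refine ⟨add3 y v z, hf _ _ _ hy hv hz, ?_⟩
        rw [hadd]
        abel
      smul_mem' := by
        rintro c _ ⟨y, hy, rfl⟩
        have hc : c = 0 ∨ c = 1 := by revert c; decide
        rcases hc with rfl | rfl
        · exact ⟨v, hv, by rw [zero_smul, hself]⟩
        · exact ⟨y, hy, one_smul _ _⟩ }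
  have hW : vec a + vec v ∉ W := by
    rintro ⟨y, hy, h⟩
    rw [hvec (add_right_cancel h)] at ha
    simp [hy] at ha
  obtain ⟨φ, hφ, hWφ⟩ := Submodule.exists_le_ker_of_notMem hW
  refine ⟨(i₀, true) :: (i₀, false) ::
    ((List.finRange k).filter fun i => φ (fun j => if i = j then 1 else 0) = 1).map
      fun i => (i, !(v i)), ?_⟩
  have key : ∀ x, bitCast (evalXorClause ((i₀, true) :: (i₀, false) ::
      ((List.finRange k).filter fun i => φ (fun j => if i = j then 1 else 0) = 1).map
        fun i => (i, !(v i))) x) = 1 + φ (vec x + vec v) := by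
    intro x
    rw [evalXorClause, List.foldr_cons, List.foldr_cons, ← evalXorClause, bitCast_xor,
      bitCast_xor, bitCast_evalXorClause, ← Fin.sum_univ_def, LinearMap.pi_apply_eq_sum_univ φ,
      ← add_assoc]
    congr 1
    simp only [Literal.eval]
    cases x i₀ <;> decide
  constructor
  · intro x hx
    apply bitCast_injective
    rw [key, show φ (vec x + vec v) = 0 from hWφ ⟨x, hx, rfl⟩]
    decide
  · apply bitCast_injective
    rw [key]
    revert hφ
    generalize φ (vec a + vec v) = b
    revert b
    decide

theorem Constraint.isAffine_of_add3 (C : Constraint)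
    (hC : ∀ u v w, C.toFun u = true → C.toFun v = true → C.toFun w = true →
      C.toFun (add3 u v w) = true) : C.IsAffine := by
  classical
  by_cases hne : ∃ v, C.toFun v = true
  · obtain ⟨v, hv⟩ := hne
    choose c hc hca using
      fun (a : Fin C.arity → Bool) (ha : C.toFun a = false) =>
        exists_separating_xorClause C.toFun hC hv ha
    refine ⟨(Finset.univ : Finset {a // C.toFun a = false}).toList.map fun a => c a.1 a.2,
      fun x => ?_⟩
    rw [Bool.eq_iff_iff]
    simp only [evalXorCNF, List.all_eq_true, List.mem_map, Finset.mem_toList, Finset.mem_univ,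
      true_and, forall_exists_index]
    constructor
    · rintro hx _ a rfl
      exact hc a.1 a.2 x hx
    · intro h
      by_contra hx
      have hx' : C.toFun x = false := by simpa using hx
      have := h _ ⟨x, hx'⟩ rfl
      simp [hca x hx'] at this
  · refine ⟨[[]], fun x => ?_⟩
    have : C.toFun x = false := by
      by_contra hx
      exact hne ⟨x, by simpa using hx⟩
    simp [this, evalXorCNF, evalXorClause]

/-! ### A face of the cube with exactly three satisfying assignments -/

/-- The assignment `x` lies on the smallest face of the cube that contains `s₀`, `s₁`, `s₂`. -/
def OnFace {k : ℕ} (s₀ s₁ s₂ x : Fin k → Bool) : Prop :=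
  ∀ i, s₀ i = s₁ i → s₁ i = s₂ i → x i = s₀ i

/-- Three satisfying assignments of `f` whose sum falsifies `f` and that span a face on which
every other such triple of assignments spans the whole face. -/
structure MinimalNonaffine {k : ℕ} (f : (Fin k → Bool) → Bool) (s₀ s₁ s₂ : Fin k → Bool) :
    Prop where
  sat₀ : f s₀ = true
  sat₁ : f s₁ = true
  sat₂ : f s₂ = true
  sum : f (add3 s₀ s₁ s₂) ≠ true
  closed : ∀ a b c, f a = true → f b = true → f c = true → OnFace s₀ s₁ s₂ a →
    OnFace s₀ s₁ s₂ b → OnFace s₀ s₁ s₂ c →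
    ∀ i, ¬(s₀ i = s₁ i ∧ s₁ i = s₂ i) → a i = b i → b i = c i → f (add3 a b c) = true

namespace MinimalNonaffine

variable {k : ℕ} {f : (Fin k → Bool) → Bool} {s₀ s₁ s₂ : Fin k → Bool}

theorem onFace_swap₀₁ (x : Fin k → Bool) : OnFace s₁ s₀ s₂ x ↔ OnFace s₀ s₁ s₂ x := by
  constructor <;> intro h i h1 h2
  · rw [h i h1.symm (h1.trans h2), h1]
  · rw [h i h1.symm (h1.trans h2), h1]

theorem onFace_swap₁₂ (x : Fin k → Bool) : OnFace s₀ s₂ s₁ x ↔ OnFace s₀ s₁ s₂ x := by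
  constructor <;> intro h i h1 h2
  · exact h i (h1.trans h2) h2.symm
  · exact h i (h1.trans h2) h2.symm

theorem swap₀₁ (h : MinimalNonaffine f s₀ s₁ s₂) : MinimalNonaffine f s₁ s₀ s₂ where
  sat₀ := h.sat₁
  sat₁ := h.sat₀
  sat₂ := h.sat₂
  sum := by
    have : add3 s₁ s₀ s₂ = add3 s₀ s₁ s₂ := by
      funext i
      exact Bool.xor_left_comm _ _ _
    rw [this]
    exact h.sum
  closed := by
    intro a b c fa fb fc ha hb hc i hi
    rw [onFace_swap₀₁] at ha hb hc
    exact h.closed a b c fa fb fc ha hb hc i fun h' => hi ⟨h'.1.symm, h'.1.trans h'.2⟩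

theorem swap₁₂ (h : MinimalNonaffine f s₀ s₁ s₂) : MinimalNonaffine f s₀ s₂ s₁ where
  sat₀ := h.sat₀
  sat₁ := h.sat₂
  sat₂ := h.sat₁
  sum := by
    have : add3 s₀ s₂ s₁ = add3 s₀ s₁ s₂ := by
      funext i
      simp only [add3]
      rw [Bool.xor_comm (s₂ i)]
    rw [this]
    exact h.sum
  closed := by
    intro a b c fa fb fc ha hb hc i hi
    rw [onFace_swap₁₂] at ha hb hc
    exact h.closed a b c fa fb fc ha hb hc i fun h' => hi ⟨h'.1.trans h'.2, h'.2.symm⟩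

theorem onFace₀ : OnFace s₀ s₁ s₂ s₀ := fun _ _ _ => rfl

theorem onFace₁ : OnFace s₀ s₁ s₂ s₁ := fun _ h _ => h.symm

theorem onFace₂ : OnFace s₀ s₁ s₂ s₂ := fun _ h h' => (h.trans h').symm

theorem onFace_add3 {a b c : Fin k → Bool} (ha : OnFace s₀ s₁ s₂ a) (hb : OnFace s₀ s₁ s₂ b)
    (hc : OnFace s₀ s₁ s₂ c) : OnFace s₀ s₁ s₂ (add3 a b c) := by
  intro i h1 h2
  simp only [add3, ha i h1 h2, hb i h1 h2, hc i h1 h2]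
  cases s₀ i <;> rfl

/-- A satisfying assignment on the face that agrees with `s₁` and `s₂` at one coordinate at which
`s₀` is the odd one out agrees with them at all such coordinates: otherwise `s₀`, `t` and
`t + s₁ + s₂` would agree at one of these coordinates, and their sum is `s₀ + s₁ + s₂`. -/
theorem agree_of_agree (h : MinimalNonaffine f s₀ s₁ s₂) {t : Fin k → Bool} (ft : f t = true)
    (ht : OnFace s₀ s₁ s₂ t) {i : Fin k} (hi : s₁ i = s₂ i) (hi' : s₀ i ≠ s₁ i)
    (hti : t i = s₁ i) :
    f (add3 t s₁ s₂) = true ∧ ∀ j, s₁ j = s₂ j → s₀ j ≠ s₁ j → t j = s₁ j := by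
  have h1 : f (add3 t s₁ s₂) = true :=
    h.closed _ _ _ ft h.sat₁ h.sat₂ ht onFace₁ onFace₂ i (fun h' => hi' h'.1) hti hi
  refine ⟨h1, fun j hj hj' => ?_⟩
  by_contra hne
  refine h.sum ?_
  have hsum : add3 s₀ s₁ s₂ = add3 s₀ t (add3 t s₁ s₂) := by
    funext l
    simp only [add3]
    cases t l <;> simp
  rw [hsum]
  refine h.closed _ _ _ h.sat₀ ft h1 onFace₀ ht (onFace_add3 ht onFace₁ onFace₂) j
    (fun h' => hj' h'.1) ?_ ?_
  · revert hne hj'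
    generalize t j = a; generalize s₁ j = b; generalize s₀ j = c
    revert a b c
    decide
  · simp only [add3, hj]
    cases t j <;> cases s₂ j <;> rfl

/-- If there are coordinates of all three kinds then no satisfying assignment on the face
disagrees with each `sᵢ` wherever `sᵢ` is the odd one out. -/
theorem not_all_disagree (h : MinimalNonaffine f s₀ s₁ s₂) {z : Fin k → Bool} (fz : f z = true)
    (hz : OnFace s₀ s₁ s₂ z)
    (hA : ∃ i, s₁ i = s₂ i ∧ s₀ i ≠ s₁ i ∧ z i = s₁ i)
    (hB : ∃ i, s₀ i = s₂ i ∧ s₁ i ≠ s₀ i ∧ z i = s₀ i)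
    (hC : ∃ i, s₀ i = s₁ i ∧ s₂ i ≠ s₀ i ∧ z i = s₀ i) : False := by
  obtain ⟨a, ha, ha', hza⟩ := hA
  obtain ⟨b, hb, hb', hzb⟩ := hB
  obtain ⟨c, hc, hc', hzc⟩ := hC
  have h1 := (h.agree_of_agree fz hz ha ha' hza).1
  have h2 := (h.swap₀₁.agree_of_agree fz ((onFace_swap₀₁ _).2 hz) hb hb' hzb).1
  refine h.sum ?_
  have hsum : add3 s₀ s₁ s₂ = add3 (add3 z s₁ s₂) (add3 z s₀ s₂) s₂ := by
    funext l
    simp only [add3]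
    cases z l <;> cases s₀ l <;> cases s₁ l <;> cases s₂ l <;> rfl
  rw [hsum]
  refine h.closed _ _ _ h1 h2 h.sat₂ (onFace_add3 hz onFace₁ onFace₂)
    (onFace_add3 hz onFace₀ onFace₂) onFace₂ c (fun h' => hc' (h'.1.trans h'.2).symm) ?_ ?_
  · simp only [add3, hc]
  · simp only [add3, hzc]
    cases s₀ c <;> cases s₂ c <;> rfl

/-- A satisfying assignment on the face that agrees with `s₀` and `s₁` where these are the odd
ones out, but not with `s₂`, is `s₀` or `s₁`. -/
theorem eq_of_agree_two (h : MinimalNonaffine f s₀ s₁ s₂) {t : Fin k → Bool} (ft : f t = true)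
    (ht : OnFace s₀ s₁ s₂ t) (hA : ∀ i, s₁ i = s₂ i → s₀ i ≠ s₁ i → t i = s₀ i)
    (hB : ∀ i, s₀ i = s₂ i → s₁ i ≠ s₀ i → t i = s₁ i)
    (hC : ∃ i, s₀ i = s₁ i ∧ s₂ i ≠ s₀ i ∧ t i = s₀ i) : t = s₀ ∨ t = s₁ := by
  obtain ⟨c, hc, hc', htc⟩ := hC
  obtain ⟨h1, h2⟩ := h.swap₁₂.swap₀₁.agree_of_agree ft
    ((onFace_swap₀₁ _).2 ((onFace_swap₁₂ _).2 ht)) hc hc' htc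
  by_cases hA' : ∃ i, s₁ i = s₂ i ∧ s₀ i ≠ s₁ i
  · by_cases hB' : ∃ i, s₀ i = s₂ i ∧ s₁ i ≠ s₀ i
    · exfalso
      obtain ⟨a, ha, ha'⟩ := hA'
      obtain ⟨b, hb, hb'⟩ := hB'
      refine h.not_all_disagree h1 (onFace_add3 ht onFace₀ onFace₁)
        ⟨a, ha, ha', ?_⟩ ⟨b, hb, hb', ?_⟩ ⟨c, hc, hc', ?_⟩
      · simp only [add3, hA a ha ha']
        cases s₀ a <;> cases s₁ a <;> rfl
      · simp only [add3, hB b hb hb']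
        cases s₀ b <;> cases s₁ b <;> rfl
      · simp only [add3, htc, hc]
        cases s₁ c <;> rfl
    · left
      funext i
      by_cases e1 : s₁ i = s₂ i
      · by_cases e0 : s₀ i = s₁ i
        · exact ht i e0 e1
        · exact hA i e1 e0
      · by_cases e0 : s₀ i = s₁ i
        · exact h2 i e0 (fun e => e1 (e0.symm.trans e.symm))
        · refine absurd ⟨i, ?_, Ne.symm e0⟩ hB'
          revert e1 e0
          generalize s₀ i = a; generalize s₁ i = b; generalize s₂ i = c
          revert a b c
          decide
  · right
    funext i
    by_cases e0 : s₀ i = s₁ i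
    · by_cases e1 : s₁ i = s₂ i
      · rw [ht i e0 e1, e0]
      · rw [h2 i e0 (fun e => e1 (e0.symm.trans e.symm)), e0]
    · by_cases e1 : s₁ i = s₂ i
      · exact absurd ⟨i, e1, e0⟩ hA'
      · refine hB i ?_ (Ne.symm e0)
        revert e1 e0
        generalize s₀ i = a; generalize s₁ i = b; generalize s₂ i = c
        revert a b c
        decide

/-- At least two of the three assignments are the odd one out at some coordinate, since they are
distinct. -/
theorem exists_odd (h : MinimalNonaffine f s₀ s₁ s₂) :
    (∃ i, s₁ i = s₂ i ∧ s₀ i ≠ s₁ i) ∨ ∃ i, s₀ i = s₂ i ∧ s₁ i ≠ s₀ i := by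
  by_contra hno
  push Not at hno
  obtain ⟨hA, hB⟩ := hno
  refine h.sum ?_
  have : add3 s₀ s₁ s₂ = s₂ := by
    funext i
    have hA := hA i
    have hB := hB i
    simp only [add3]
    revert hA hB
    generalize s₀ i = a; generalize s₁ i = b; generalize s₂ i = c
    revert a b c
    decide
  rw [this]
  exact h.sat₂

/-- The three assignments are the only satisfying assignments on the face. -/
theorem eq_or_eq_or_eq (h : MinimalNonaffine f s₀ s₁ s₂) {t : Fin k → Bool} (ft : f t = true)
    (ht : OnFace s₀ s₁ s₂ t) : t = s₀ ∨ t = s₁ ∨ t = s₂ := by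
  have flip : ∀ a b c : Bool, a ≠ b → c ≠ a → c = b := by decide
  have kinds : ∀ i, (s₀ i = s₁ i ∧ s₁ i = s₂ i) ∨ (s₁ i = s₂ i ∧ s₀ i ≠ s₁ i) ∨
      (s₀ i = s₂ i ∧ s₁ i ≠ s₀ i) ∨ (s₀ i = s₁ i ∧ s₂ i ≠ s₀ i) := by
    intro i
    generalize s₀ i = a; generalize s₁ i = b; generalize s₂ i = c
    revert a b c
    decide
  by_cases hA : ∀ i, s₁ i = s₂ i → s₀ i ≠ s₁ i → t i = s₀ i
  · by_cases hB : ∀ i, s₀ i = s₂ i → s₁ i ≠ s₀ i → t i = s₁ i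
    · by_cases hC : ∀ i, s₀ i = s₁ i → s₂ i ≠ s₀ i → t i = s₂ i
      · exfalso
        refine h.sum ?_
        have : add3 s₀ s₁ s₂ = t := by
          funext i
          simp only [add3]
          rcases kinds i with ⟨h1, h2⟩ | ⟨h1, h2⟩ | ⟨h1, h2⟩ | ⟨h1, h2⟩
          · rw [ht i h1 h2, ← h2, ← h1]; cases s₀ i <;> rfl
          · rw [hA i h1 h2, h1]; cases s₀ i <;> cases s₂ i <;> rfl
          · rw [hB i h1 h2, h1]; cases s₁ i <;> cases s₂ i <;> rfl
          · rw [hC i h1 h2, h1]; cases s₁ i <;> cases s₂ i <;> rfl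
        rwa [this]
      · push Not at hC
        obtain ⟨c, hc, hc', htc⟩ := hC
        rcases h.eq_of_agree_two ft ht hA hB ⟨c, hc, hc', flip _ _ _ hc' htc⟩ with e | e
        · exact .inl e
        · exact .inr (.inl e)
    · push Not at hB
      obtain ⟨b, hb, hb', htb⟩ := hB
      by_cases hC : ∀ i, s₀ i = s₁ i → s₂ i ≠ s₀ i → t i = s₂ i
      · rcases h.swap₁₂.eq_of_agree_two ft ((onFace_swap₁₂ _).2 ht)
          (fun i e e' => hA i e.symm (fun e'' => e' (e''.trans e.symm)))
          (fun i e e' => hC i e e') ⟨b, hb, hb', flip _ _ _ hb' htb⟩ with e | e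
        · exact .inl e
        · exact .inr (.inr e)
      · push Not at hC
        obtain ⟨c, hc, hc', htc⟩ := hC
        have hb2 := flip _ _ _ hb' htb
        have hc2 := flip _ _ _ hc' htc
        have h2 := (h.swap₀₁.agree_of_agree ft ((onFace_swap₀₁ _).2 ht) hb hb' hb2).2
        have h3 := (h.swap₁₂.swap₀₁.agree_of_agree ft
          ((onFace_swap₀₁ _).2 ((onFace_swap₁₂ _).2 ht)) hc hc' hc2).2
        left
        funext i
        rcases kinds i with ⟨e1, e2⟩ | ⟨e1, e2⟩ | ⟨e1, e2⟩ | ⟨e1, e2⟩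
        · exact ht i e1 e2
        · exact hA i e1 e2
        · exact h2 i e1 e2
        · exact h3 i e1 e2
  · push Not at hA
    obtain ⟨a, ha, ha', hta⟩ := hA
    have ha2 := flip _ _ _ ha' hta
    have h1 := (h.agree_of_agree ft ht ha ha' ha2).2
    by_cases hB : ∀ i, s₀ i = s₂ i → s₁ i ≠ s₀ i → t i = s₁ i
    · by_cases hC : ∀ i, s₀ i = s₁ i → s₂ i ≠ s₀ i → t i = s₂ i
      · right
        rcases h.swap₀₁.swap₁₂.eq_of_agree_two ft ((onFace_swap₁₂ _).2 ((onFace_swap₀₁ _).2 ht))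
          (fun i e e' => hB i e.symm (fun e'' => e' (e''.trans e.symm)))
          (fun i e e' => hC i e.symm (fun e'' => e' (e''.trans e.symm)))
          ⟨a, ha, ha', ha2⟩ with e | e
        · exact .inl e
        · exact .inr e
      · push Not at hC
        obtain ⟨c, hc, hc', htc⟩ := hC
        have hc2 := flip _ _ _ hc' htc
        have h3 := (h.swap₁₂.swap₀₁.agree_of_agree ft
          ((onFace_swap₀₁ _).2 ((onFace_swap₁₂ _).2 ht)) hc hc' hc2).2
        right; left
        funext i
        rcases kinds i with ⟨e1, e2⟩ | ⟨e1, e2⟩ | ⟨e1, e2⟩ | ⟨e1, e2⟩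
        · rw [ht i e1 e2, e1]
        · exact h1 i e1 e2
        · exact hB i e1 e2
        · rw [h3 i e1 e2, e1]
    · push Not at hB
      obtain ⟨b, hb, hb', htb⟩ := hB
      have hb2 := flip _ _ _ hb' htb
      have h2 := (h.swap₀₁.agree_of_agree ft ((onFace_swap₀₁ _).2 ht) hb hb' hb2).2
      by_cases hC : ∀ i, s₀ i = s₁ i → s₂ i ≠ s₀ i → t i = s₂ i
      · right; right
        funext i
        rcases kinds i with ⟨e1, e2⟩ | ⟨e1, e2⟩ | ⟨e1, e2⟩ | ⟨e1, e2⟩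
        · rw [ht i e1 e2, e1, e2]
        · rw [h1 i e1 e2, e1]
        · rw [h2 i e1 e2, e1]
        · exact hC i e1 e2
      · push Not at hC
        obtain ⟨c, hc, hc', htc⟩ := hC
        exact absurd (h.not_all_disagree ft ht ⟨a, ha, ha', ha2⟩ ⟨b, hb, hb', hb2⟩
          ⟨c, hc, hc', flip _ _ _ hc' htc⟩) id

end MinimalNonaffine

/-- Three satisfying assignments whose sum falsifies `f` can be chosen to be minimal. -/
theorem exists_minimalNonaffine {k : ℕ} (f : (Fin k → Bool) → Bool)
    (h : ∃ u v w, f u = true ∧ f v = true ∧ f w = true ∧ f (add3 u v w) ≠ true) :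
    ∃ s₀ s₁ s₂, MinimalNonaffine f s₀ s₁ s₂ := by
  classical
  let D : (Fin k → Bool) × (Fin k → Bool) × (Fin k → Bool) → Finset (Fin k) :=
    fun s => Finset.univ.filter fun i => ¬(s.1 i = s.2.1 i ∧ s.2.1 i = s.2.2 i)
  let B : Set ((Fin k → Bool) × (Fin k → Bool) × (Fin k → Bool)) :=
    {s | f s.1 = true ∧ f s.2.1 = true ∧ f s.2.2 = true ∧ f (add3 s.1 s.2.1 s.2.2) ≠ true}
  obtain ⟨u, v, w, hbad⟩ := h
  obtain ⟨⟨s₀, s₁, s₂⟩, ⟨h0, h1, h2, h3⟩, hmin⟩ :=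
    Set.exists_min_image B (fun s => (D s).card) (Set.toFinite B) ⟨(u, v, w), hbad⟩
  refine ⟨s₀, s₁, s₂, h0, h1, h2, h3, fun a b c fa fb fc ha hb hc i hi hab hbc => ?_⟩
  by_contra hne
  have hle := hmin (a, b, c) ⟨fa, fb, fc, hne⟩
  refine absurd hle (not_le.mpr (Finset.card_lt_card ?_))
  refine (Finset.ssubset_iff_of_subset fun j hj => ?_).mpr ⟨i, ?_, ?_⟩
  · simp only [D, Finset.mem_filter, Finset.mem_univ, true_and] at hj ⊢
    rintro ⟨e1, e2⟩
    exact hj ⟨by rw [ha j e1 e2, hb j e1 e2], by rw [hb j e1 e2, hc j e1 e2]⟩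
  · simpa [D] using hi
  · simp [D, hab, hbc]

/-- The assignments `s₀`, `s₁`, `s₂` are the only satisfying assignments of `f` on a face of the
cube, and there are coordinates at which `s₀` is the odd one out and coordinates at which `s₁`
is. -/
structure ThreePointFace {k : ℕ} (f : (Fin k → Bool) → Bool) (s₀ s₁ s₂ : Fin k → Bool) :
    Prop where
  iff : ∀ x, OnFace s₀ s₁ s₂ x → (f x = true ↔ x = s₀ ∨ x = s₁ ∨ x = s₂)
  odd₀ : ∃ i, s₁ i = s₂ i ∧ s₀ i ≠ s₁ i
  odd₁ : ∃ i, s₀ i = s₂ i ∧ s₁ i ≠ s₀ i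

theorem MinimalNonaffine.threePointFace {k : ℕ} {f : (Fin k → Bool) → Bool}
    {s₀ s₁ s₂ : Fin k → Bool} (h : MinimalNonaffine f s₀ s₁ s₂)
    (h₀ : ∃ i, s₁ i = s₂ i ∧ s₀ i ≠ s₁ i) (h₁ : ∃ i, s₀ i = s₂ i ∧ s₁ i ≠ s₀ i) :
    ThreePointFace f s₀ s₁ s₂ where
  iff x hx := by
    refine ⟨fun fx => h.eq_or_eq_or_eq fx hx, ?_⟩
    rintro (rfl | rfl | rfl)
    exacts [h.sat₀, h.sat₁, h.sat₂]
  odd₀ := h₀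
  odd₁ := h₁

theorem exists_threePointFace (C : Constraint) (hC : ¬ C.IsAffine) :
    ∃ s₀ s₁ s₂, ThreePointFace C.toFun s₀ s₁ s₂ := by
  have hbad : ∃ u v w, C.toFun u = true ∧ C.toFun v = true ∧ C.toFun w = true ∧
      C.toFun (add3 u v w) ≠ true := by
    by_contra hno
    push Not at hno
    exact hC (C.isAffine_of_add3 hno)
  obtain ⟨s₀, s₁, s₂, h⟩ := exists_minimalNonaffine C.toFun hbad
  by_cases h₀ : ∃ i, s₁ i = s₂ i ∧ s₀ i ≠ s₁ i
  · by_cases h₁ : ∃ i, s₀ i = s₂ i ∧ s₁ i ≠ s₀ i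
    · exact ⟨_, _, _, h.threePointFace h₀ h₁⟩
    · obtain ⟨a, ha, ha'⟩ := h₀
      obtain ⟨c, hc, hc'⟩ := h.swap₀₁.swap₁₂.exists_odd.resolve_left
        fun ⟨i, hi, hi'⟩ => h₁ ⟨i, hi.symm, fun e => hi' (e.trans hi.symm)⟩
      exact ⟨_, _, _, h.swap₁₂.threePointFace ⟨a, ha.symm, fun e => ha' (e.trans ha.symm)⟩
        ⟨c, hc.symm, fun e => hc' (e.trans hc.symm)⟩⟩
  · obtain ⟨b, hb, hb'⟩ := h.exists_odd.resolve_left h₀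
    obtain ⟨c, hc, hc'⟩ := h.swap₁₂.exists_odd.resolve_left
      fun ⟨i, hi, hi'⟩ => h₀ ⟨i, hi.symm, fun e => hi' (e.trans hi.symm)⟩
    exact ⟨_, _, _, h.swap₀₁.swap₁₂.threePointFace
      ⟨b, hb.symm, fun e => hb' (e.trans hb.symm)⟩
      ⟨c, hc.symm, fun e => hc' (e.trans hc.symm)⟩⟩

end BoolIso

namespace BoolIso

/-! ### The gadget -/

/-- The kind of a coordinate with respect to three assignments: these are equal there, or one of
them is the odd one out. -/
inductive Kind
  | const
  | first
  | second
  | third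
  deriving DecidableEq

/-- The kind of the coordinate `c` with respect to `s₀`, `s₁`, `s₂`. -/
def kind {k : ℕ} (s₀ s₁ s₂ : Fin k → Bool) (c : Fin k) : Kind :=
  if s₁ c = s₂ c then if s₀ c = s₁ c then .const else .first
  else if s₀ c = s₂ c then .second else .third

/-- The arguments of the gadget for three objects: the coordinates at which `s₀`, `s₁`, `s₂` is the
odd one out are taken from the first, second, third object, and constants are inserted at the
remaining coordinates. -/
def gadget {k : ℕ} (s₀ s₁ s₂ : Fin k → Bool) (o₁ o₂ o₃ : Fin k → Bool) : Fin k → Bool := fun c =>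
  match kind s₀ s₁ s₂ c with
  | .const => s₀ c
  | .first => o₁ c
  | .second => o₂ c
  | .third => o₃ c

section Gadget

variable {k : ℕ} {f : (Fin k → Bool) → Bool} {s₀ s₁ s₂ : Fin k → Bool}

theorem kind_first {c : Fin k} : kind s₀ s₁ s₂ c = .first ↔ s₁ c = s₂ c ∧ s₀ c ≠ s₁ c := by
  unfold kind
  generalize s₀ c = a; generalize s₁ c = b; generalize s₂ c = d
  revert a b d
  decide

theorem kind_second {c : Fin k} : kind s₀ s₁ s₂ c = .second ↔ s₀ c = s₂ c ∧ s₁ c ≠ s₀ c := by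
  unfold kind
  generalize s₀ c = a; generalize s₁ c = b; generalize s₂ c = d
  revert a b d
  decide

theorem kind_third {c : Fin k} : kind s₀ s₁ s₂ c = .third ↔ s₀ c = s₁ c ∧ s₂ c ≠ s₀ c := by
  unfold kind
  generalize s₀ c = a; generalize s₁ c = b; generalize s₂ c = d
  revert a b d
  decide

theorem kind_const {c : Fin k} : kind s₀ s₁ s₂ c = .const ↔ s₀ c = s₁ c ∧ s₁ c = s₂ c := by
  unfold kind
  generalize s₀ c = a; generalize s₁ c = b; generalize s₂ c = d
  revert a b d
  decide

theorem ThreePointFace.gadget_iff (h : ThreePointFace f s₀ s₁ s₂) (o₁ o₂ o₃ : Fin k → Bool) :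
    f (gadget s₀ s₁ s₂ o₁ o₂ o₃) = true ↔ gadget s₀ s₁ s₂ o₁ o₂ o₃ = s₀ ∨
      gadget s₀ s₁ s₂ o₁ o₂ o₃ = s₁ ∨ gadget s₀ s₁ s₂ o₁ o₂ o₃ = s₂ := by
  refine h.iff _ fun c h1 h2 => ?_
  simp [gadget, kind_const.2 ⟨h1, h2⟩]

/-- The gadget is satisfied if its objects represent `α`, `β` and "neither `α` nor `β`", and not
both `α` and `β` hold. -/
theorem ThreePointFace.gadget_eq_true (h : ThreePointFace f s₀ s₁ s₂) {o₁ o₂ o₃ : Fin k → Bool}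
    (α β : Bool) (hαβ : ¬(α = true ∧ β = true))
    (h₁ : ∀ c, kind s₀ s₁ s₂ c = .first → o₁ c = (s₀ c == α))
    (h₂ : ∀ c, kind s₀ s₁ s₂ c = .second → o₂ c = (s₁ c == β))
    (h₃ : ∀ c, kind s₀ s₁ s₂ c = .third → o₃ c = (s₂ c == (!α && !β))) :
    f (gadget s₀ s₁ s₂ o₁ o₂ o₃) = true := by
  have bit : ∀ a b : Bool, a ≠ b → (a == false) = b := by decide
  have bit' : ∀ a : Bool, (a == true) = a := by decide
  rw [h.gadget_iff]
  cases α
  · cases β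
    · right; right
      funext c
      unfold gadget
      split
      · exact (kind_const.1 ‹_›).1.trans (kind_const.1 ‹_›).2
      · rw [h₁ c ‹_›]
        exact (bit _ _ (kind_first.1 ‹_›).2).trans (kind_first.1 ‹_›).1
      · rw [h₂ c ‹_›]
        exact (bit _ _ (kind_second.1 ‹_›).2).trans (kind_second.1 ‹_›).1
      · rw [h₃ c ‹_›]
        exact bit' _
    · right; left
      funext c
      unfold gadget
      split
      · exact (kind_const.1 ‹_›).1
      · rw [h₁ c ‹_›]
        exact bit _ _ (kind_first.1 ‹_›).2
      · rw [h₂ c ‹_›]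
        exact bit' _
      · rw [h₃ c ‹_›]
        exact (bit _ _ (kind_third.1 ‹_›).2).trans (kind_third.1 ‹_›).1
  · cases β
    · left
      funext c
      unfold gadget
      split
      · rfl
      · rw [h₁ c ‹_›]
        exact bit' _
      · rw [h₂ c ‹_›]
        exact bit _ _ (kind_second.1 ‹_›).2
      · rw [h₃ c ‹_›]
        exact bit _ _ (kind_third.1 ‹_›).2
    · exact absurd ⟨rfl, rfl⟩ hαβ

theorem gadget_first {o₁ o₂ o₃ : Fin k → Bool} {c : Fin k} (hc : kind s₀ s₁ s₂ c = .first) :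
    gadget s₀ s₁ s₂ o₁ o₂ o₃ c = o₁ c := by
  simp [gadget, hc]

theorem gadget_second {o₁ o₂ o₃ : Fin k → Bool} {c : Fin k} (hc : kind s₀ s₁ s₂ c = .second) :
    gadget s₀ s₁ s₂ o₁ o₂ o₃ c = o₂ c := by
  simp [gadget, hc]

theorem ThreePointFace.not_both (h : ThreePointFace f s₀ s₁ s₂) {o₁ o₂ o₃ : Fin k → Bool}
    (hf : f (gadget s₀ s₁ s₂ o₁ o₂ o₃) = true) {a b : Fin k} (ha : kind s₀ s₁ s₂ a = .first)
    (hb : kind s₀ s₁ s₂ b = .second) : ¬(o₂ b = s₁ b ∧ o₁ a = s₀ a) := by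
  rintro ⟨h2, h1⟩
  rw [← gadget_first ha (o₁ := o₁) (o₂ := o₂) (o₃ := o₃)] at h1
  rw [← gadget_second hb (o₁ := o₁) (o₂ := o₂) (o₃ := o₃)] at h2
  rw [kind_first] at ha
  rw [kind_second] at hb
  rcases (h.gadget_iff _ _ _).1 hf with e | e | e
  · exact hb.2 (by rw [← h2, e])
  · exact ha.2 (by rw [← h1, e])
  · exact ha.2 (by rw [← h1, e, ha.1])

theorem ThreePointFace.first_iff (h : ThreePointFace f s₀ s₁ s₂) {o₁ o₂ o₃ : Fin k → Bool}
    (hf : f (gadget s₀ s₁ s₂ o₁ o₂ o₃) = true) {a a' : Fin k} (ha : kind s₀ s₁ s₂ a = .first)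
    (ha' : kind s₀ s₁ s₂ a' = .first) (h1 : o₁ a = s₀ a) : o₁ a' = s₀ a' := by
  rw [← gadget_first ha (o₁ := o₁) (o₂ := o₂) (o₃ := o₃)] at h1
  rw [← gadget_first ha' (o₁ := o₁) (o₂ := o₂) (o₃ := o₃)]
  rw [kind_first] at ha
  rcases (h.gadget_iff _ _ _).1 hf with e | e | e
  · rw [e]
  · exact absurd (by rw [← h1, e]) ha.2
  · exact absurd (by rw [← h1, e, ha.1]) ha.2

end Gadget

/-! ### The constraints of a graph -/

/-- The number of pairing objects of an ordered pair of vertices. It exceeds the number of variables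
on which a variable that does not belong to a vertex can depend. -/
abbrev multiplicity (k : ℕ) : ℕ := 4 * k + 2

/-- The objects used in the constraints of a graph of order `n`; every object comes with `k`
variables. There is an object for every vertex, and for every ordered pair of vertices there are
pairing objects and an auxiliary object. -/
inductive Obj (k n : ℕ)
  | vertex (i : Fin n)
  | pair (i j : Fin n) (t : Fin (multiplicity k))
  | aux (i j : Fin n)
  deriving DecidableEq

/-- The assignment `J` satisfies the constraints of the graph `G`: a gadget links every vertex `i`
with every pairing object of a pair `(i, j)`, and if `i` and `j` are adjacent then another gadget
links `j` with the first of these pairing objects. -/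
def Model {k n : ℕ} (f : (Fin k → Bool) → Bool) (s₀ s₁ s₂ : Fin k → Bool)
    (G : SimpleGraph (Fin n)) (J : Obj k n → Fin k → Bool) : Prop :=
  (∀ i j t, f (gadget s₀ s₁ s₂ (J (.vertex i)) (J (.pair i j t)) (J (.pair i j t))) = true) ∧
    ∀ i j, G.Adj i j → f (gadget s₀ s₁ s₂ (J (.vertex j)) (J (.pair i j 0)) (J (.aux i j))) = true

/-- The variable `c` of an object occurs in the constraints of the graph `G`. -/
def Used {k n : ℕ} (s₀ s₁ s₂ : Fin k → Bool) (G : SimpleGraph (Fin n)) :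
    Obj k n × Fin k → Prop
  | (.vertex _, c) => kind s₀ s₁ s₂ c = .first
  | (.pair _ _ _, c) => kind s₀ s₁ s₂ c = .second ∨ kind s₀ s₁ s₂ c = .third
  | (.aux i j, c) => kind s₀ s₁ s₂ c = .third ∧ G.Adj i j

/-- The values of the variables in the solution given by the truth values `α` of the vertices and
`β` of the pairing objects. -/
def value {k n : ℕ} (s₀ s₁ s₂ : Fin k → Bool) (α : Fin n → Bool)
    (β : Fin n → Fin n → Fin (multiplicity k) → Bool) : Obj k n × Fin k → Bool
  | (.vertex i, c) => s₀ c == α i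
  | (.pair i j t, c) =>
    if kind s₀ s₁ s₂ c = .second then s₁ c == β i j t else s₂ c == (!(α i) && !(β i j t))
  | (.aux i j, c) => s₂ c == (!(α j) && !(β i j 0))

/-- Two variables are dependent with respect to a set of assignments if some combination of values
does not occur. -/
def Dependent {X : Type} (A : Set (X → Bool)) (u w : X) : Prop :=
  ∃ b b', ∀ I ∈ A, ¬(I u = b ∧ I w = b')

theorem Dependent.symm {X : Type} {A : Set (X → Bool)} {u w : X} (h : Dependent A u w) :
    Dependent A w u := by
  obtain ⟨b, b', h⟩ := h
  exact ⟨b', b, fun I hI hb => h I hI hb.symm⟩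

open Classical in
/-- A variable that depends on more than `m` variables. -/
def HighlyDependent {X : Type} [Fintype X] (A : Set (X → Bool)) (m : ℕ) (u : X) : Prop :=
  m < (Finset.univ.filter (Dependent A u)).card

section Recover

variable {k n : ℕ} {f : (Fin k → Bool) → Bool} {s₀ s₁ s₂ : Fin k → Bool}
  {G : SimpleGraph (Fin n)} {X : Type} {ι : Obj k n × Fin k → X}

/-- The solutions, over the variables `X`, of the constraints of a graph whose variables are
embedded into `X` by `ι`. -/
def solutions (f : (Fin k → Bool) → Bool) (s₀ s₁ s₂ : Fin k → Bool) (G : SimpleGraph (Fin n))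
    (ι : Obj k n × Fin k → X) : Set (X → Bool) :=
  {I | Model f s₀ s₁ s₂ G fun o c => I (ι (o, c))}

/-- The truth values `α` of the vertices and `β` of the pairing objects give a solution. -/
def Compatible (G : SimpleGraph (Fin n)) (α : Fin n → Bool)
    (β : Fin n → Fin n → Fin (multiplicity k) → Bool) : Prop :=
  (∀ i j t, ¬(α i = true ∧ β i j t = true)) ∧
    ∀ i j, G.Adj i j → ¬(α j = true ∧ β i j 0 = true)

/-- Every compatible family of truth values gives a solution, in which the variables that do not
occur in the constraints have arbitrary values. -/
theorem exists_solution (h : ThreePointFace f s₀ s₁ s₂) (hι : Function.Injective ι)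
    {α : Fin n → Bool} {β : Fin n → Fin n → Fin (multiplicity k) → Bool}
    (hαβ : Compatible G α β) (r : X → Bool) :
    ∃ I ∈ solutions f s₀ s₁ s₂ G ι, (∀ y, Used s₀ s₁ s₂ G y → I (ι y) = value s₀ s₁ s₂ α β y) ∧
      ∀ x, (∀ y, Used s₀ s₁ s₂ G y → ι y ≠ x) → I x = r x := by
  classical
  let I : X → Bool := fun x =>
    if hx : ∃ y, Used s₀ s₁ s₂ G y ∧ ι y = x then value s₀ s₁ s₂ α β hx.choose else r x
  have hI : ∀ y, Used s₀ s₁ s₂ G y → I (ι y) = value s₀ s₁ s₂ α β y := by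
    intro y hy
    have hx : ∃ y', Used s₀ s₁ s₂ G y' ∧ ι y' = ι y := ⟨y, hy, rfl⟩
    simp only [I, dif_pos hx]
    rw [hι hx.choose_spec.2]
  refine ⟨I, ⟨fun i j t => ?_, fun i j hij => ?_⟩, hI, fun x hx => ?_⟩
  · refine h.gadget_eq_true (α i) (β i j t) (hαβ.1 i j t) (fun c hc => hI (.vertex i, c) hc)
      (fun c hc => ?_) fun c hc => ?_
    · refine (hI (.pair i j t, c) (.inl hc)).trans ?_
      simp [value, hc]
    · refine (hI (.pair i j t, c) (.inr hc)).trans ?_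
      simp [value, hc]
  · refine h.gadget_eq_true (α j) (β i j 0) (hαβ.2 i j hij)
      (fun c hc => hI (.vertex j, c) hc) (fun c hc => ?_) fun c hc => ?_
    · refine (hI (.pair i j 0, c) (.inl hc)).trans ?_
      simp [value, hc]
    · refine (hI (.aux i j, c) ⟨hc, hij⟩).trans ?_
      simp [value]
  · exact dif_neg fun ⟨y, hy, hyx⟩ => hx y hy hyx

/-- A variable of a pairing object or auxiliary object that occurs in the constraints and whose
value is determined by the truth value of the pairing object `(i, j, t)` as long as the vertices linked
with that object are false. -/
def Governed (s₀ s₁ s₂ : Fin k → Bool) (G : SimpleGraph (Fin n)) (i j : Fin n)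
    (t : Fin (multiplicity k)) (y : Obj k n × Fin k) : Prop :=
  Used s₀ s₁ s₂ G y ∧ (y.1 = .pair i j t ∨ y.1 = .aux i j ∧ t = 0)

theorem Governed.exists_value {i j : Fin n} {t : Fin (multiplicity k)} {y : Obj k n × Fin k}
    (hy : Governed s₀ s₁ s₂ G i j t y) :
    ∃ σ : Bool, ∀ α β, α i = false → (G.Adj i j → α j = false) →
      value s₀ s₁ s₂ α β y = xor σ (β i j t) := by
  have bit : ∀ a b : Bool, (a == b) = xor (!a) b := by decide
  have bit' : ∀ a b : Bool, (a == !b) = xor a b := by decide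
  obtain ⟨o, c⟩ := y
  obtain ⟨hu, rfl | ⟨rfl, rfl⟩⟩ := hy
  · by_cases hc : kind s₀ s₁ s₂ c = .second
    · exact ⟨!(s₁ c), fun α β _ _ => by simp only [value, hc, if_true, bit]⟩
    · exact ⟨s₂ c, fun α β hα _ => by
        simp only [value, hc, if_false, hα, Bool.not_false, Bool.true_and, bit']⟩
  · exact ⟨s₂ c, fun α β _ hα => by
      simp only [value, hα hu.2, Bool.not_false, Bool.true_and, bit']⟩

/-- Every variable does not occur in the constraints, belongs to a vertex, or is governed by a
pairing object. -/
theorem variable_cases (s₀ s₁ s₂ : Fin k → Bool) (G : SimpleGraph (Fin n))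
    (ι : Obj k n × Fin k → X) (x : X) :
    (∀ y, Used s₀ s₁ s₂ G y → ι y ≠ x) ∨
      (∃ i a, kind s₀ s₁ s₂ a = .first ∧ x = ι (.vertex i, a)) ∨
      ∃ i j t y, Governed s₀ s₁ s₂ G i j t y ∧ x = ι y := by
  by_cases hx : ∃ y, Used s₀ s₁ s₂ G y ∧ ι y = x
  · obtain ⟨⟨o, c⟩, hy, rfl⟩ := hx
    cases o with
    | vertex i => exact .inr (.inl ⟨i, c, hy, rfl⟩)
    | pair i j t => exact .inr (.inr ⟨i, j, t, _, ⟨hy, .inl rfl⟩, rfl⟩)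
    | aux i j => exact .inr (.inr ⟨i, j, 0, _, ⟨hy, .inr ⟨rfl, rfl⟩⟩, rfl⟩)
  · exact .inl fun y hy hyx => hx ⟨y, hy, hyx⟩

theorem not_dependent {A : Set (X → Bool)} {u w : X}
    (h : ∀ b b', ∃ I ∈ A, I u = b ∧ I w = b') : ¬ Dependent A u w := by
  rintro ⟨b, b', hb⟩
  obtain ⟨I, hI, h1⟩ := h b b'
  exact hb I hI h1

theorem xor_xor_self_left (σ b : Bool) : xor σ (xor σ b) = b := by
  cases σ <;> simp

theorem beq_beq_self_left (s b : Bool) : (s == (s == b)) = b := by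
  cases s <;> cases b <;> rfl

theorem compatible_false (G : SimpleGraph (Fin n))
    (β : Fin n → Fin n → Fin (multiplicity k) → Bool) : Compatible G (fun _ => false) β :=
  ⟨fun _ _ _ h => Bool.false_ne_true h.1, fun _ _ _ h => Bool.false_ne_true h.1⟩

theorem compatible_false' (G : SimpleGraph (Fin n)) (α : Fin n → Bool) :
    Compatible (k := k) G α (fun _ _ _ => false) :=
  ⟨fun _ _ _ h => Bool.false_ne_true h.2, fun _ _ _ h => Bool.false_ne_true h.2⟩

/-- A variable that does not occur in the constraints depends on no other variable. -/
theorem eq_of_dependent_unused (h : ThreePointFace f s₀ s₁ s₂) (hι : Function.Injective ι) {x w : X}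
    (hx : ∀ y, Used s₀ s₁ s₂ G y → ι y ≠ x) (hd : Dependent (solutions f s₀ s₁ s₂ G ι) x w) :
    w = x := by
  classical
  by_contra hne
  refine not_dependent (fun b b' => ?_) hd
  rcases variable_cases s₀ s₁ s₂ G ι w with hw | ⟨i, a, ha, rfl⟩ | ⟨i, j, t, y, hy, rfl⟩
  · obtain ⟨I, hI, -, h2⟩ := exists_solution h hι
      (compatible_false G fun _ _ _ => false) fun z => if z = x then b else b'
    exact ⟨I, hI, by simp [h2 x hx], by simp [h2 w hw, hne]⟩
  · obtain ⟨I, hI, h1, h2⟩ := exists_solution h hι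
      (compatible_false' G fun _ => s₀ a == b') fun _ => b
    refine ⟨I, hI, h2 x hx, ?_⟩
    rw [h1 (.vertex i, a) ha]
    exact beq_beq_self_left _ _
  · obtain ⟨σ, hσ⟩ := hy.exists_value
    obtain ⟨I, hI, h1, h2⟩ := exists_solution h hι
      (compatible_false G fun _ _ _ => xor σ b') fun _ => b
    refine ⟨I, hI, h2 x hx, ?_⟩
    rw [h1 _ hy.1, hσ _ _ rfl fun _ => rfl, xor_xor_self_left]

/-- A variable governed by the pairing object `(i, j, t)` depends only on variables of the objects
that are linked with this pairing object. -/
theorem Governed.of_dependent (h : ThreePointFace f s₀ s₁ s₂) (hι : Function.Injective ι)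
    {i j : Fin n} {t : Fin (multiplicity k)} {y : Obj k n × Fin k}
    (hy : Governed s₀ s₁ s₂ G i j t y) {x : X}
    (hd : Dependent (solutions f s₀ s₁ s₂ G ι) (ι y) x) :
    ∃ o c, x = ι (o, c) ∧
      (o = .vertex i ∨ o = .pair i j t ∨ o = .aux i j ∨ (G.Adj i j ∧ o = .vertex j)) := by
  classical
  by_contra hno
  refine not_dependent (fun b b' => ?_) hd
  obtain ⟨σ, hσ⟩ := hy.exists_value
  rcases variable_cases s₀ s₁ s₂ G ι x with hw | ⟨l, a, ha, rfl⟩ | ⟨i', j', t', y', hy', rfl⟩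
  · obtain ⟨I, hI, h1, h2⟩ := exists_solution h hι
      (compatible_false G fun _ _ _ => xor σ b) fun _ => b'
    refine ⟨I, hI, ?_, h2 x hw⟩
    rw [h1 _ hy.1, hσ _ _ rfl fun _ => rfl, xor_xor_self_left]
  · have hli : i ≠ l := fun e => hno ⟨_, _, rfl, .inl (by rw [e])⟩
    have hlj : G.Adj i j → j ≠ l := fun hadj e =>
      hno ⟨_, _, rfl, .inr (.inr (.inr ⟨hadj, by rw [e]⟩))⟩
    have hc : Compatible G (fun q => decide (q = l) && (s₀ a == b')) (fun p q r =>
        decide (p = i ∧ q = j ∧ r = t) && xor σ b) := by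
      constructor
      · intro p q r hp
        simp only [Bool.and_eq_true, decide_eq_true_eq] at hp
        exact hli (hp.2.1.1.symm.trans hp.1.1)
      · intro p q hadj hp
        simp only [Bool.and_eq_true, decide_eq_true_eq] at hp
        obtain ⟨⟨e1, -⟩, ⟨e2, e3, -⟩, -⟩ := hp
        subst e2 e3
        exact hlj hadj e1
    obtain ⟨I, hI, h1, -⟩ := exists_solution h hι hc fun _ => false
    refine ⟨I, hI, ?_, ?_⟩
    · rw [h1 _ hy.1, hσ _ _ (by simp [hli]) fun hadj => by simp [hlj hadj]]
      simp
    · rw [h1 (.vertex l, a) ha]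
      simp only [value, decide_true, Bool.true_and]
      exact beq_beq_self_left _ _
  · obtain ⟨σ', hσ'⟩ := hy'.exists_value
    have hne : ¬(i' = i ∧ j' = j ∧ t' = t) := by
      rintro ⟨rfl, rfl, rfl⟩
      rcases hy'.2 with e | ⟨e, -⟩
      · exact hno ⟨y'.1, y'.2, rfl, .inr (.inl e)⟩
      · exact hno ⟨y'.1, y'.2, rfl, .inr (.inr (.inl e))⟩
    obtain ⟨I, hI, h1, -⟩ := exists_solution h hι
      (compatible_false G fun p q r => if p = i ∧ q = j ∧ r = t then xor σ b else xor σ' b')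
      fun _ => false
    refine ⟨I, hI, ?_, ?_⟩
    · rw [h1 _ hy.1, hσ _ _ rfl fun _ => rfl]
      simp
    · rw [h1 _ hy'.1, hσ' _ _ rfl fun _ => rfl, if_neg hne, xor_xor_self_left]

theorem dependent_pair_vertex (h : ThreePointFace f s₀ s₁ s₂) {a b : Fin k}
    (ha : kind s₀ s₁ s₂ a = .first) (hb : kind s₀ s₁ s₂ b = .second) (i j : Fin n)
    (t : Fin (multiplicity k)) :
    Dependent (solutions f s₀ s₁ s₂ G ι) (ι (.pair i j t, b)) (ι (.vertex i, a)) :=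
  ⟨s₁ b, s₀ a, fun _ hI => h.not_both (hI.1 i j t) ha hb⟩

theorem dependent_pair_vertex_of_adj (h : ThreePointFace f s₀ s₁ s₂) {a b : Fin k}
    (ha : kind s₀ s₁ s₂ a = .first) (hb : kind s₀ s₁ s₂ b = .second) {i j : Fin n}
    (hij : G.Adj i j) :
    Dependent (solutions f s₀ s₁ s₂ G ι) (ι (.pair i j 0, b)) (ι (.vertex j, a)) :=
  ⟨s₁ b, s₀ a, fun _ hI => h.not_both (hI.2 i j hij) ha hb⟩

/-- Variables of vertices are dependent if and only if they belong to the same vertex. -/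
theorem dependent_vertex_iff (h : ThreePointFace f s₀ s₁ s₂) (hι : Function.Injective ι)
    {a a' : Fin k} (ha : kind s₀ s₁ s₂ a = .first) (ha' : kind s₀ s₁ s₂ a' = .first)
    {i j : Fin n} :
    Dependent (solutions f s₀ s₁ s₂ G ι) (ι (.vertex i, a)) (ι (.vertex j, a')) ↔ i = j := by
  constructor
  · intro hd
    by_contra hne
    refine not_dependent (fun b b' => ?_) hd
    obtain ⟨I, hI, h1, -⟩ := exists_solution h hι
      (compatible_false' G fun l => if l = i then s₀ a == b else s₀ a' == b') fun _ => false
    refine ⟨I, hI, ?_, ?_⟩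
    · rw [h1 (.vertex i, a) ha]
      simp only [value, if_true]
      exact beq_beq_self_left _ _
    · rw [h1 (.vertex j, a') ha']
      simp only [value, if_neg (Ne.symm hne)]
      exact beq_beq_self_left _ _
  · rintro rfl
    refine ⟨s₀ a, !(s₀ a'), fun I hI hb => ?_⟩
    have : I (ι (.vertex i, a')) = s₀ a' := h.first_iff (hI.1 i i 0) ha ha' hb.1
    rw [hb.2] at this
    cases hs : s₀ a' <;> simp [hs] at this

variable [Fintype X]

/-- The variables of vertices are those that depend on many variables. -/
theorem highlyDependent_iff (h : ThreePointFace f s₀ s₁ s₂) (hι : Function.Injective ι) (x : X) :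
    HighlyDependent (solutions f s₀ s₁ s₂ G ι) (4 * k + 1) x ↔
      ∃ i a, kind s₀ s₁ s₂ a = .first ∧ x = ι (.vertex i, a) := by
  classical
  constructor
  · intro hx
    rcases variable_cases s₀ s₁ s₂ G ι x with hw | hw | ⟨i, j, t, y, hy, rfl⟩
    · exfalso
      refine absurd hx (not_lt.mpr ?_)
      calc _ ≤ ({x} : Finset X).card := Finset.card_le_card fun w hw' => by
            simp only [Finset.mem_filter, Finset.mem_univ, true_and] at hw'
            rw [Finset.mem_singleton, eq_of_dependent_unused h hι hw hw']
        _ ≤ 4 * k + 1 := by simp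
    · exact hw
    · exfalso
      refine absurd hx (not_lt.mpr ?_)
      calc _ ≤ ((({.vertex i, .pair i j t, .aux i j, .vertex j} : Finset (Obj k n)) ×ˢ
              (Finset.univ : Finset (Fin k))).image ι).card :=
            Finset.card_le_card fun w hw' => by
              simp only [Finset.mem_filter, Finset.mem_univ, true_and] at hw'
              obtain ⟨o, c, rfl, ho⟩ := hy.of_dependent h hι hw'
              refine Finset.mem_image_of_mem _ (Finset.mem_product.2 ⟨?_, Finset.mem_univ _⟩)
              rcases ho with rfl | rfl | rfl | ⟨-, rfl⟩ <;> simp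
        _ ≤ _ := Finset.card_image_le
        _ = _ := Finset.card_product _ _
        _ ≤ 4 * k := by
          rw [Finset.card_univ, Fintype.card_fin]
          exact Nat.mul_le_mul_right _ Finset.card_le_four
        _ ≤ 4 * k + 1 := Nat.le_succ _
  · rintro ⟨i, a, ha, rfl⟩
    obtain ⟨b, hb⟩ := h.odd₁
    rw [← kind_second] at hb
    have hinj : Function.Injective fun t : Fin (multiplicity k) => ι (.pair i i t, b) := by
      intro t t' e
      have := hι e
      simpa using this
    calc 4 * k + 1 < (Finset.univ : Finset (Fin (multiplicity k))).card := by simp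
      _ = (Finset.univ.image fun t : Fin (multiplicity k) => ι (.pair i i t, b)).card :=
        (Finset.card_image_of_injective _ hinj).symm
      _ ≤ _ := Finset.card_le_card fun w hw => by
        obtain ⟨t, -, rfl⟩ := Finset.mem_image.1 hw
        simp only [Finset.mem_filter, Finset.mem_univ, true_and]
        exact (dependent_pair_vertex h ha hb i i t).symm

/-- Two vertices are adjacent if and only if some variable that does not belong to a vertex depends
on both. -/
theorem exists_dependent_iff_adj (h : ThreePointFace f s₀ s₁ s₂) (hι : Function.Injective ι)
    {a a' : Fin k} (ha : kind s₀ s₁ s₂ a = .first) (ha' : kind s₀ s₁ s₂ a' = .first)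
    {i j : Fin n} (hij : i ≠ j) :
    (∃ u, ¬ HighlyDependent (solutions f s₀ s₁ s₂ G ι) (4 * k + 1) u ∧
      Dependent (solutions f s₀ s₁ s₂ G ι) u (ι (.vertex i, a)) ∧
      Dependent (solutions f s₀ s₁ s₂ G ι) u (ι (.vertex j, a'))) ↔ G.Adj i j := by
  constructor
  · rintro ⟨u, hu, hi, hj⟩
    rcases variable_cases s₀ s₁ s₂ G ι u with hw | hw | ⟨p, q, t, y, hy, rfl⟩
    · refine absurd ((highlyDependent_iff h hι _).2 ⟨i, a, ha, ?_⟩) hu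
      exact (eq_of_dependent_unused h hι hw hi).symm
    · exact absurd ((highlyDependent_iff h hι _).2 hw) hu
    · have key : ∀ (l : Fin n) (c : Fin k),
          Dependent (solutions f s₀ s₁ s₂ G ι) (ι y) (ι (.vertex l, c)) →
            l = p ∨ (G.Adj p q ∧ l = q) := by
        intro l c hd
        obtain ⟨o, c', e, ho⟩ := hy.of_dependent h hι hd
        have e' := (Prod.mk.inj (hι e)).1
        rw [← e'] at ho
        simpa using ho
      rcases key i a hi with rfl | ⟨hadj, rfl⟩
      · rcases key j a' hj with rfl | ⟨hadj, rfl⟩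
        · exact absurd rfl hij
        · exact hadj
      · rcases key j a' hj with rfl | ⟨-, rfl⟩
        · exact hadj.symm
        · exact absurd rfl hij
  · intro hadj
    obtain ⟨b, hb⟩ := h.odd₁
    rw [← kind_second] at hb
    refine ⟨ι (.pair i j 0, b), fun hu => ?_, dependent_pair_vertex h ha hb i j 0,
      dependent_pair_vertex_of_adj h ha' hb hadj⟩
    obtain ⟨l, c, -, e⟩ := (highlyDependent_iff h hι _).1 hu
    have := (Prod.mk.inj (hι e)).1
    simp at this

/-- The graph can be recovered from the solutions of its constraints. -/
theorem nonempty_iso_of_solutions_eq {m : ℕ} {H : SimpleGraph (Fin m)} {ι' : Obj k m × Fin k → X}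
    (h : ThreePointFace f s₀ s₁ s₂) (hι : Function.Injective ι) (hι' : Function.Injective ι')
    (hS : solutions f s₀ s₁ s₂ G ι = solutions f s₀ s₁ s₂ H ι') : Nonempty (G ≃g H) := by
  obtain ⟨a, ha⟩ := h.odd₀
  rw [← kind_first] at ha
  have hG := highlyDependent_iff (G := G) h hι
  have hH := highlyDependent_iff (G := H) h hι'
  rw [hS] at hG
  have hφ : ∀ i, ∃ i' c, kind s₀ s₁ s₂ c = .first ∧ ι (.vertex i, a) = ι' (.vertex i', c) :=
    fun i => (hH _).1 ((hG _).2 ⟨i, a, ha, rfl⟩)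
  choose φ c hc hφc using hφ
  have dG := fun {a a'} ha ha' i j =>
    dependent_vertex_iff (G := G) (a := a) (a' := a') h hι ha ha' (i := i) (j := j)
  have dH := fun {a a'} ha ha' i j =>
    dependent_vertex_iff (G := H) (a := a) (a' := a') h hι' ha ha' (i := i) (j := j)
  rw [hS] at dG
  have hinj : Function.Injective φ := by
    intro i j hij
    rw [← dG ha ha, hφc, hφc, dH (hc i) (hc j)]
    exact hij
  have hsurj : Function.Surjective φ := by
    intro i'
    obtain ⟨i, c', hc', e⟩ := (hG _).1 ((hH _).2 ⟨i', a, ha, rfl⟩)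
    refine ⟨i, ?_⟩
    rw [← dH (hc i) ha, ← hφc, e, dG ha hc']
  refine ⟨⟨Equiv.ofBijective φ ⟨hinj, hsurj⟩, fun {i j} => ?_⟩⟩
  change H.Adj (φ i) (φ j) ↔ G.Adj i j
  by_cases hij : i = j
  · subst hij
    simp
  · have aG := exists_dependent_iff_adj (G := G) h hι ha ha hij
    have aH := exists_dependent_iff_adj (G := H) h hι' (hc i) (hc j) (hinj.ne hij)
    rw [← aG, ← aH, hS, hφc, hφc]

end Recover

end BoolIso

namespace BoolIso

/-! ### The constraint applications of a graph -/

namespace Obj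

variable {k n : ℕ}

/-- The position of an object: the vertices come first, and then, for every ordered pair of
vertices, its pairing objects followed by its auxiliary object. -/
def index : Obj k n → ℕ
  | vertex i => i
  | pair i j t => n + ((multiplicity k + 1) * (j + n * i) + t)
  | aux i j => n + ((multiplicity k + 1) * (j + n * i) + multiplicity k)

theorem add_mul_injective {q a b a' b' : ℕ} (ha : a < q) (ha' : a' < q)
    (h : q * b + a = q * b' + a') : b = b' ∧ a = a' := by
  have hq : 0 < q := by omega
  have h1 : (q * b + a) / q = b := by
    rw [Nat.mul_add_div hq, Nat.div_eq_of_lt ha, Nat.add_zero]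
  have h2 : (q * b' + a') / q = b' := by
    rw [Nat.mul_add_div hq, Nat.div_eq_of_lt ha', Nat.add_zero]
  have h3 : b = b' := by rw [← h1, h, h2]
  subst h3
  exact ⟨rfl, by omega⟩

theorem mul_add_lt {q a b c : ℕ} (ha : a < q) (hb : b < c) : q * b + a < q * c :=
  calc q * b + a < q * b + q := by omega
    _ = q * (b + 1) := by ring
    _ ≤ q * c := Nat.mul_le_mul_left _ hb

theorem index_lt (o : Obj k n) : o.index < n + (multiplicity k + 1) * (n * n) := by
  have hp : ∀ i j : Fin n, (j : ℕ) + n * i < n * n := fun i j => by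
    have := mul_add_lt j.2 i.2
    omega
  cases o with
  | vertex i => exact lt_of_lt_of_le i.2 (Nat.le_add_right _ _)
  | pair i j t =>
    exact Nat.add_lt_add_left (mul_add_lt (lt_trans t.2 (Nat.lt_succ_self _)) (hp i j)) _
  | aux i j => exact Nat.add_lt_add_left (mul_add_lt (Nat.lt_succ_self _) (hp i j)) _

theorem index_injective : Function.Injective (index (k := k) (n := n)) := by
  have hp : ∀ {i j i' j' : Fin n}, (j : ℕ) + n * i = j' + n * i' → i = i' ∧ j = j' := by
    intro i j i' j' h
    rw [Nat.add_comm (j : ℕ), Nat.add_comm (j' : ℕ)] at h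
    obtain ⟨h1, h2⟩ := add_mul_injective j.2 j'.2 h
    exact ⟨Fin.ext h1, Fin.ext h2⟩
  have hm : multiplicity k < multiplicity k + 1 := Nat.lt_succ_self _
  rintro (i | ⟨i, j, t⟩ | ⟨i, j⟩) (i' | ⟨i', j', t'⟩ | ⟨i', j'⟩) h
  · exact congrArg vertex (Fin.ext h)
  · have := i.2
    simp only [index] at h
    omega
  · have := i.2
    simp only [index] at h
    omega
  · have := i'.2
    simp only [index] at h
    omega
  · obtain ⟨h1, h2⟩ := add_mul_injective (lt_trans t.2 hm) (lt_trans t'.2 hm)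
      (Nat.add_left_cancel h)
    obtain ⟨rfl, rfl⟩ := hp h1
    rw [Fin.ext h2]
  · obtain ⟨-, h2⟩ := add_mul_injective (lt_trans t.2 hm) hm (Nat.add_left_cancel h)
    exact absurd h2 t.2.ne
  · have := i'.2
    simp only [index] at h
    omega
  · obtain ⟨-, h2⟩ := add_mul_injective hm (lt_trans t'.2 hm) (Nat.add_left_cancel h)
    exact absurd h2.symm t'.2.ne
  · obtain ⟨h1, -⟩ := add_mul_injective hm hm (Nat.add_left_cancel h)
    obtain ⟨rfl, rfl⟩ := hp h1
    rfl

/-- The objects of isomorphic graphs correspond to each other. -/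
def map {m : ℕ} (φ : Fin n → Fin m) : Obj k n → Obj k m
  | vertex i => vertex (φ i)
  | pair i j t => pair (φ i) (φ j) t
  | aux i j => aux (φ i) (φ j)

theorem map_injective {m : ℕ} {φ : Fin n → Fin m} (hφ : Function.Injective φ) :
    Function.Injective (map (k := k) φ) := by
  rintro (i | ⟨i, j, t⟩ | ⟨i, j⟩) (i' | ⟨i', j', t'⟩ | ⟨i', j'⟩) h <;>
    simp_all [map, hφ.eq_iff]

end Obj

/-- The number of variables in the constraints of a graph of order `n`. -/
def varCount (k n : ℕ) : ℕ := k * (n + (multiplicity k + 1) * (n * n))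

/-- The variables of the objects of a graph, as elements of a sufficiently large set of
variables. -/
def varIndex {k n N : ℕ} (hN : varCount k n ≤ N) (y : Obj k n × Fin k) : Fin N :=
  ⟨k * y.1.index + y.2, lt_of_lt_of_le (Obj.mul_add_lt y.2.2 y.1.index_lt) hN⟩

theorem varIndex_injective {k n N : ℕ} (hN : varCount k n ≤ N) :
    Function.Injective (varIndex hN) := by
  rintro ⟨o, c⟩ ⟨o', c'⟩ h
  obtain ⟨h1, h2⟩ := Obj.add_mul_injective c.2 c'.2 (congrArg Fin.val h)
  exact Prod.ext (Obj.index_injective h1) (Fin.ext h2)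

section Applications

variable {𝒞 : Finset Constraint} {C : Constraint} (hC : C ∈ 𝒞) (s₀ s₁ s₂ : Fin C.arity → Bool)
  {n N : ℕ} (ι : Obj C.arity n × Fin C.arity → Fin N)

/-- The application of the constraint `C` that realises the gadget for three objects. -/
def gadgetApplication (o₁ o₂ o₃ : Obj C.arity n) : Application 𝒞 N where
  constraint := C
  mem := hC
  args c :=
    match kind s₀ s₁ s₂ c with
    | .const => .const (s₀ c)
    | .first => .var (ι (o₁, c))
    | .second => .var (ι (o₂, c))
    | .third => .var (ι (o₃, c))

theorem gadgetApplication_eval (o₁ o₂ o₃ : Obj C.arity n) (I : Fin N → Bool) :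
    (gadgetApplication hC s₀ s₁ s₂ ι o₁ o₂ o₃).eval I =
      C.toFun (gadget s₀ s₁ s₂ (fun c => I (ι (o₁, c))) (fun c => I (ι (o₂, c)))
        fun c => I (ι (o₃, c))) := by
  refine congrArg C.toFun (funext fun (c : Fin C.arity) => ?_)
  cases hc : kind s₀ s₁ s₂ c <;> simp only [gadgetApplication, gadget, hc] <;> rfl

theorem gadgetApplication_rename (o₁ o₂ o₃ : Obj C.arity n) (π : Equiv.Perm (Fin N)) :
    (gadgetApplication hC s₀ s₁ s₂ ι o₁ o₂ o₃).rename π =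
      gadgetApplication hC s₀ s₁ s₂ (π ∘ ι) o₁ o₂ o₃ := by
  simp only [gadgetApplication, Application.rename]
  congr 1
  funext c
  split <;> rfl

/-- The applications for an ordered pair of vertices, given whether these are adjacent. -/
def pairApplications (adj : Bool) (i j : Fin n) : List (Application 𝒞 N) :=
  (List.finRange (multiplicity C.arity)).map (fun t =>
    gadgetApplication hC s₀ s₁ s₂ ι (.vertex i) (.pair i j t) (.pair i j t)) ++
  if adj then [gadgetApplication hC s₀ s₁ s₂ ι (.vertex j) (.pair i j 0) (.aux i j)] else []

open Classical in
/-- The constraint applications of a graph. -/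
noncomputable def graphApplications (G : SimpleGraph (Fin n)) : List (Application 𝒞 N) :=
  (List.finRange n).flatMap fun i => (List.finRange n).flatMap fun j =>
    pairApplications hC s₀ s₁ s₂ ι (decide (G.Adj i j)) i j

theorem satisfies_graphApplications (G : SimpleGraph (Fin n)) (I : Fin N → Bool) :
    Satisfies I (graphApplications hC s₀ s₁ s₂ ι G) ↔ I ∈ solutions C.toFun s₀ s₁ s₂ G ι := by
  classical
  constructor
  · intro h
    refine ⟨fun i j t => ?_, fun i j hij => ?_⟩
    · rw [← gadgetApplication_eval hC]
      refine h _ (List.mem_flatMap.2 ⟨i, List.mem_finRange _, List.mem_flatMap.2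
        ⟨j, List.mem_finRange _, List.mem_append_left _ ?_⟩⟩)
      exact List.mem_map_of_mem (List.mem_finRange t)
    · rw [← gadgetApplication_eval hC]
      refine h _ (List.mem_flatMap.2 ⟨i, List.mem_finRange _, List.mem_flatMap.2
        ⟨j, List.mem_finRange _, List.mem_append_right _ ?_⟩⟩)
      simp [hij]
  · rintro ⟨h1, h2⟩ A hA
    obtain ⟨i, -, hA⟩ := List.mem_flatMap.1 hA
    obtain ⟨j, -, hA⟩ := List.mem_flatMap.1 hA
    rcases List.mem_append.1 hA with hA | hA
    · obtain ⟨t, -, rfl⟩ := List.mem_map.1 hA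
      rw [gadgetApplication_eval]
      exact h1 i j t
    · by_cases hij : G.Adj i j
      · simp only [hij, decide_true, if_true, List.mem_singleton] at hA
        rw [hA, gadgetApplication_eval]
        exact h2 i j hij
      · simp [hij] at hA

theorem graphApplications_map_rename (G : SimpleGraph (Fin n)) (π : Equiv.Perm (Fin N)) :
    (graphApplications hC s₀ s₁ s₂ ι G).map (Application.rename π) =
      graphApplications hC s₀ s₁ s₂ (π ∘ ι) G := by
  simp only [graphApplications, List.map_flatMap, pairApplications, List.map_append, List.map_map]
  congr 1
  funext i
  congr 1
  funext j
  congr 1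
  · refine List.map_congr_left fun t _ => ?_
    exact gadgetApplication_rename ..
  · split
    · simp [gadgetApplication_rename]
    · rfl

theorem satisfies_map_rename (G : SimpleGraph (Fin n)) (π : Equiv.Perm (Fin N))
    (I : Fin N → Bool) :
    Satisfies I ((graphApplications hC s₀ s₁ s₂ ι G).map (Application.rename π)) ↔
      I ∈ solutions C.toFun s₀ s₁ s₂ G (π ∘ ι) := by
  rw [graphApplications_map_rename, satisfies_graphApplications]

end Applications

/-- Any two embeddings of a finite type into a finite type differ by a permutation. -/
theorem exists_perm_comp_eq {Y X : Type} [Finite X] {ι ι' : Y → X} (hι : Function.Injective ι)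
    (hι' : Function.Injective ι') : ∃ π : Equiv.Perm X, π ∘ ι = ι' := by
  classical
  have := Fintype.ofFinite X
  let e : {x // x ∈ Set.range ι} ≃ {x // x ∈ Set.range ι'} :=
    (Equiv.ofInjective ι hι).symm.trans (Equiv.ofInjective ι' hι')
  refine ⟨e.extendSubtype, funext fun y => ?_⟩
  rw [Function.comp_apply, Equiv.extendSubtype_apply_of_mem e (ι y) ⟨y, rfl⟩]
  have : (Equiv.ofInjective ι hι).symm ⟨ι y, y, rfl⟩ = y := by
    rw [Equiv.symm_apply_eq]
    rfl
  simp only [e, Equiv.trans_apply, this]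
  rfl

/-- An isomorphism of graphs carries the constraints of one to those of the other. -/
theorem solutions_map {k n m : ℕ} (f : (Fin k → Bool) → Bool) (s₀ s₁ s₂ : Fin k → Bool)
    {G : SimpleGraph (Fin n)} {H : SimpleGraph (Fin m)} (φ : G ≃g H) {X : Type}
    (ι' : Obj k m × Fin k → X) :
    solutions f s₀ s₁ s₂ G (fun y => ι' (y.1.map φ, y.2)) = solutions f s₀ s₁ s₂ H ι' := by
  ext I
  refine and_congr ?_ ?_
  · rw [φ.surjective.forall₂]
    rfl
  · rw [φ.surjective.forall₂]
    refine forall₂_congr fun i j => ?_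
    rw [φ.map_adj_iff]
    rfl

section Reduction

variable {𝒞 : Finset Constraint} {C : Constraint} (hC : C ∈ 𝒞) (s₀ s₁ s₂ : Fin C.arity → Bool)

/-- The instance of the constraint isomorphism problem for a pair of graphs. -/
noncomputable def reduction (p : Graph × Graph) : IsoInstance 𝒞 where
  numVars := varCount C.arity p.1.order + varCount C.arity p.2.order
  S := graphApplications hC s₀ s₁ s₂ (varIndex (Nat.le_add_right _ _)) p.1.graph
  U := graphApplications hC s₀ s₁ s₂ (varIndex (Nat.le_add_left _ _)) p.2.graph

theorem reduction_correct {s₀ s₁ s₂ : Fin C.arity → Bool}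
    (h : ThreePointFace C.toFun s₀ s₁ s₂) (p : Graph × Graph) :
    GI.Yes p ↔ (ISOc 𝒞).Yes (reduction hC s₀ s₁ s₂ p) := by
  have key : (ISOc 𝒞).Yes (reduction hC s₀ s₁ s₂ p) ↔
      ∃ π : Equiv.Perm (Fin (varCount C.arity p.1.order + varCount C.arity p.2.order)),
        solutions C.toFun s₀ s₁ s₂ p.1.graph (π ∘ varIndex (Nat.le_add_right _ _)) =
          solutions C.toFun s₀ s₁ s₂ p.2.graph (varIndex (Nat.le_add_left _ _)) := by
    refine exists_congr fun π => ?_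
    rw [Set.ext_iff]
    refine forall_congr' fun I => ?_
    exact iff_congr (satisfies_map_rename ..) (satisfies_graphApplications ..)
  rw [key]
  constructor
  · rintro ⟨φ⟩
    obtain ⟨π, hπ⟩ := exists_perm_comp_eq
      (varIndex_injective (Nat.le_add_right (varCount C.arity p.1.order)
        (varCount C.arity p.2.order)))
      (ι' := fun y => varIndex (Nat.le_add_left (varCount C.arity p.2.order)
        (varCount C.arity p.1.order)) (y.1.map φ, y.2)) (by
      rintro ⟨o, c⟩ ⟨o', c'⟩ e
      obtain ⟨e1, e2⟩ := Prod.mk.inj (varIndex_injective _ e)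
      exact Prod.ext (Obj.map_injective φ.injective e1) e2)
    exact ⟨π, by rw [hπ, solutions_map]⟩
  · rintro ⟨π, hπ⟩
    exact nonempty_iso_of_solutions_eq h (π.injective.comp (varIndex_injective _))
      (varIndex_injective _) hπ

end Reduction

end BoolIso

namespace BoolIso

/-! ### Running times of composite programs -/

namespace StackProgram

open Function

variable {K : Type}

/-- An item of a text with parameters: a bit, or the contents of a stack. -/
inductive Item (K : Type)
  | bit (b : Bool)
  | stack (k : K)

/-- The text described by a list of items. -/
def text (S : K → List Bool) (l : List (Item K)) : List Bool :=
  l.flatMap fun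
    | .bit b => [b]
    | .stack k => S k

theorem text_append (S : K → List Bool) (l l' : List (Item K)) :
    text S (l ++ l') = text S l ++ text S l' := List.flatMap_append

variable [DecidableEq K]

/-- Started with stack contents `S`, the program `p` ends with stack contents `S'` after at most `t`
steps. -/
def RunsWithin (p : StackProgram K) (S S' : K → List Bool) (t : ℕ) : Prop :=
  ∃ t' ≤ t, Run p S S' t'

namespace RunsWithin

variable {p q : StackProgram K} {S S₁ S₂ S' : K → List Bool} {t t₁ t₂ : ℕ} {k : K} {once : Bool}
  {r : List Bool}

theorem congr (h : RunsWithin p S S₁ t₁) (hS : S₁ = S₂) (ht : t₁ ≤ t₂) :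
    RunsWithin p S S₂ t₂ := by
  obtain ⟨t', ht', h'⟩ := h
  exact ⟨t', ht'.trans ht, hS ▸ h'⟩

theorem mono (h : RunsWithin p S S' t₁) (ht : t₁ ≤ t₂) : RunsWithin p S S' t₂ := by
  obtain ⟨t', ht', h'⟩ := h
  exact ⟨t', ht'.trans ht, h'⟩

theorem seq (h₁ : RunsWithin p S S₁ t₁) (h₂ : RunsWithin q S₁ S₂ t₂) :
    RunsWithin (seq p q) S S₂ (t₁ + t₂) := by
  obtain ⟨t₁', ht₁, h₁⟩ := h₁
  obtain ⟨t₂', ht₂, h₂⟩ := h₂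
  exact ⟨t₁' + t₂', add_le_add ht₁ ht₂, h₁.seq h₂⟩

theorem ifPop (b : Bool) (hS : S k = b :: r)
    (h : RunsWithin (if b then p else q) (update S k r) S' t) :
    RunsWithin (ifPop k p q) S S' (t + 1) := by
  obtain ⟨t', ht, h⟩ := h
  refine ⟨t' + 1, Nat.succ_le_succ ht, ?_⟩
  cases b
  · exact .ifPop_false hS h
  · exact .ifPop_true hS h

theorem loop_true (hS : S k = true :: r) (h₁ : RunsWithin p (update S k r) S₁ t₁)
    (h₂ : RunsWithin (loop k once p q) S₁ S₂ t₂) :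
    RunsWithin (loop k once p q) S S₂ (t₁ + t₂ + 1) := by
  obtain ⟨t₁', ht₁, h₁⟩ := h₁
  obtain ⟨t₂', ht₂, h₂⟩ := h₂
  exact ⟨t₂' + (t₁' + 1), by omega, .loop_true hS h₁ h₂⟩

theorem loop_nil (hS : S k = []) : RunsWithin (loop k once p q) S S 1 :=
  ⟨1, le_rfl, .loop_nil hS⟩

end RunsWithin

/-- The program that pushes a bit `1` on every stack in a list. -/
def pushes : List K → StackProgram K
  | [] => skip
  | k :: l => seq (push k true) (pushes l)

theorem pushes_run (l : List K) (S : K → List Bool) :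
    RunsWithin (pushes l) S (fun k => List.replicate (l.count k) true ++ S k) (l.length + 1) := by
  induction l generalizing S with
  | nil => exact ⟨1, le_rfl, .skip S⟩
  | cons k l ih =>
    have h := RunsWithin.seq ⟨1, le_rfl, .push k true S⟩ (ih (update S k (true :: S k)))
    have e : (fun i => List.replicate (l.count i) true ++ update S k (true :: S k) i) =
        fun i => List.replicate ((k :: l).count i) true ++ S i := by
      funext i
      by_cases hi : i = k
      · subst hi
        simp [List.replicate_succ']
      · rw [update_of_ne hi, List.count_cons_of_ne (Ne.symm hi)]
    rw [e] at h
    exact h.mono (by rw [List.length_cons]; omega)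

/-- The program that reads a number in unary from stack `k` and pushes that many bits `1` on every
stack in a list. -/
def distribute (k : K) (l : List K) : StackProgram K := loop k true (pushes l) skip

theorem distribute_run {k : K} {l : List K} (hk : k ∉ l) (a : ℕ) (r tail : List Bool)
    (ht : tail = [] ∧ r = [] ∨ tail = false :: r) (S : K → List Bool)
    (hS : S k = List.replicate a true ++ tail) :
    RunsWithin (distribute k l) S
      (fun i => if i = k then r else List.replicate (a * l.count i) true ++ S i)
      (a * (l.length + 2) + 2) := by
  induction a generalizing S with
  | zero =>
    have e : (fun i => if i = k then r else List.replicate (0 * l.count i) true ++ S i) =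
        update S k r := by
      funext i
      by_cases hi : i = k
      · subst hi; simp
      · simp [hi]
    rw [e]
    rcases ht with ⟨rfl, rfl⟩ | rfl
    · have hS' : S k = [] := by simpa using hS
      rw [← hS', update_eq_self]
      exact (RunsWithin.loop_nil hS').mono (by omega)
    · exact ⟨2, by omega, .loop_once (by simpa using hS) (.skip _)⟩
  | succ a ih =>
    have hS' : S k = true :: (List.replicate a true ++ tail) := by
      simpa [List.replicate_succ] using hS
    have h₁ := pushes_run l (update S k (List.replicate a true ++ tail))
    have h₂ := ih (fun i => List.replicate (l.count i) true ++
      update S k (List.replicate a true ++ tail) i) (by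
        simp [List.count_eq_zero_of_not_mem hk])
    have h := RunsWithin.loop_true hS' h₁ h₂
    have e : (fun i => if i = k then r else List.replicate ((a + 1) * l.count i) true ++ S i) =
        fun i => if i = k then r else List.replicate (a * l.count i) true ++
          (List.replicate (l.count i) true ++ update S k (List.replicate a true ++ tail) i) := by
      funext i
      by_cases hi : i = k
      · simp [hi]
      · rw [if_neg hi, if_neg hi, update_of_ne hi, ← List.append_assoc,
          List.replicate_append_replicate, Nat.succ_mul]
    rw [e]
    exact h.mono (by ring_nf; omega)

/-- The program that pushes the number on stack `src`, in unary, on stack `dst`. -/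
def copy (src scratch dst : K) : StackProgram K :=
  seq (distribute src [scratch]) (distribute scratch [src, dst])

theorem copy_run {src scratch dst : K} (h₁ : src ≠ scratch) (h₂ : src ≠ dst)
    (h₃ : scratch ≠ dst) (a : ℕ) (S : K → List Bool) (hS : S src = List.replicate a true)
    (hS' : S scratch = []) :
    RunsWithin (copy src scratch dst) S (update S dst (List.replicate a true ++ S dst))
      (7 * a + 4) := by
  have r₁ := distribute_run (k := src) (l := [scratch]) (by simpa using h₁) a [] []
    (.inl ⟨rfl, rfl⟩) S (by simpa using hS)
  have r₂ := distribute_run (k := scratch) (l := [src, dst]) (by simp [h₁.symm, h₃]) a [] []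
    (.inl ⟨rfl, rfl⟩)
    (fun i => if i = src then [] else List.replicate (a * [scratch].count i) true ++ S i)
    (by simp [h₁.symm, hS'])
  have e : (fun i => if i = scratch then [] else List.replicate (a * [src, dst].count i) true ++
      if i = src then [] else List.replicate (a * [scratch].count i) true ++ S i) =
      update S dst (List.replicate a true ++ S dst) := by
    funext i
    by_cases hi : i = scratch
    · subst hi
      simp [h₃, hS']
    · by_cases hi' : i = src
      · subst hi'
        simp [hi, h₂, hS]
      · by_cases hi'' : i = dst
        · subst hi''
          simp [hi, hi', Ne.symm hi', Ne.symm hi]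
        · simp [hi, hi', hi'', Ne.symm hi', Ne.symm hi, Ne.symm hi'']
  rw [e] at r₂
  exact (r₁.seq r₂).mono (by simp only [List.length_cons, List.length_nil]; omega)

/-- The program that pushes a text on stack `out`. -/
def emit (scratch out : K) : List (Item K) → StackProgram K
  | [] => skip
  | .bit b :: l => seq (push out b) (emit scratch out l)
  | .stack k :: l => seq (copy k scratch out) (emit scratch out l)

theorem emit_run {scratch out : K} (hne : scratch ≠ out) (M : ℕ) (l : List (Item K))
    (S : K → List Bool) (hl : ∀ k, .stack k ∈ l → k ≠ scratch ∧ k ≠ out ∧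
      ∃ a ≤ M, S k = List.replicate a true) (hS : S scratch = []) :
    RunsWithin (emit scratch out l) S (update S out ((text S l).reverse ++ S out))
      (l.length * (7 * M + 4) + 1) := by
  induction l generalizing S with
  | nil =>
    have e : update S out ((text S []).reverse ++ S out) = S := by simp [text]
    rw [e]
    exact ⟨1, by simp, .skip S⟩
  | cons x l ih =>
    have htext : ∀ L, text (update S out L) l = text S l := by
      intro L
      refine List.flatMap_congr fun y hy => ?_
      cases y with
      | bit b => rfl
      | stack k => exact update_of_ne (hl k (List.mem_cons_of_mem _ hy)).2.1 _ _
    have htail : ∀ L, RunsWithin (emit scratch out l) (update S out L)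
        (update S out ((text S l).reverse ++ L)) (l.length * (7 * M + 4) + 1) := by
      intro L
      have h := ih (update S out L) (fun k hk => ?_) (by rw [update_of_ne hne, hS])
      · rwa [htext, update_idem, update_self] at h
      · have hk' := hl k (List.mem_cons_of_mem _ hk)
        rw [update_of_ne hk'.2.1]
        exact hk'
    cases x with
    | bit b =>
      have h := RunsWithin.seq ⟨1, le_rfl, .push out b S⟩ (htail (b :: S out))
      have e : (text S (.bit b :: l)).reverse ++ S out = (text S l).reverse ++ b :: S out := by
        simp [text]
      rw [e]
      exact h.mono (by rw [List.length_cons]; ring_nf; omega)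
    | stack k =>
      obtain ⟨h1, h2, a, ha, hk⟩ := hl k List.mem_cons_self
      have h := RunsWithin.seq (copy_run h1 h2 hne a S hk hS)
        (htail (List.replicate a true ++ S out))
      have e : (text S (.stack k :: l)).reverse ++ S out =
          (text S l).reverse ++ (List.replicate a true ++ S out) := by
        simp [text, hk]
      rw [e]
      exact h.mono (by rw [List.length_cons]; ring_nf; omega)

/-- The program that pushes the contents of stack `src`, from top to bottom, on stack `dst`. -/
def pour (src dst : K) : StackProgram K := loop src false (push dst true) (push dst false)

theorem pour_run {src dst : K} (hne : src ≠ dst) (l : List Bool) (S : K → List Bool)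
    (hS : S src = l) :
    RunsWithin (pour src dst) S (update (update S src []) dst (l.reverse ++ S dst))
      (2 * l.length + 1) := by
  induction l generalizing S with
  | nil =>
    have e : update (update S src []) dst (([] : List Bool).reverse ++ S dst) = S := by
      rw [← hS, update_eq_self, hS]
      simp
    rw [e]
    exact RunsWithin.loop_nil hS
  | cons b l ih =>
    obtain ⟨t, ht, h⟩ := ih (update (update S src l) dst (b :: S dst))
      (by rw [update_of_ne hne, update_self])
    have e : update (update (update (update S src l) dst (b :: S dst)) src []) dst
        (l.reverse ++ update (update S src l) dst (b :: S dst) dst) =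
        update (update S src []) dst ((b :: l).reverse ++ S dst) := by
      rw [update_comm hne.symm, update_idem, update_idem, update_self]
      simp
    rw [e] at h
    refine ⟨t + (1 + 1), by rw [List.length_cons]; omega, ?_⟩
    have hp : ∀ c, Run (push dst c) (update S src l)
        (update (update S src l) dst (c :: S dst)) 1 := by
      intro c
      have := Run.push dst c (update S src l)
      rwa [update_of_ne hne.symm] at this
    cases b
    · exact .loop_false hS (hp false) h
    · exact .loop_true hS (hp true) h

end StackProgram

end BoolIso

namespace BoolIso

/-! ### The program of the reduction -/

open StackProgram Function

/-- The stacks of the program of the reduction. -/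
inductive Stack
  | input | output | result | scratch | addrI | addrJ | base | rows | order | cols | total
  deriving DecidableEq

instance : Fintype Stack where
  elems := {.input, .output, .result, .scratch, .addrI, .addrJ, .base, .rows, .order, .cols, .total}
  complete s := by cases s <;> decide

/-- The contents of the stacks: three stacks hold strings, one is empty, and the others hold numbers
in unary. -/
structure Contents where
  input : List Bool := []
  output : List Bool := []
  result : List Bool := []
  addrI : ℕ := 0
  addrJ : ℕ := 0
  base : ℕ := 0
  rows : ℕ := 0
  order : ℕ := 0
  cols : ℕ := 0
  total : ℕ := 0

/-- The contents of the stacks as a function of the stack. -/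
def Contents.stacks (T : Contents) : Stack → List Bool
  | .input => T.input
  | .output => T.output
  | .result => T.result
  | .scratch => []
  | .addrI => List.replicate T.addrI true
  | .addrJ => List.replicate T.addrJ true
  | .base => List.replicate T.base true
  | .rows => List.replicate T.rows true
  | .order => List.replicate T.order true
  | .cols => List.replicate T.cols true
  | .total => List.replicate T.total true

/-- The code of the variable whose number is the sum of `a` and the number on the stack `l.1`, where
`l` consists of this stack and an offset. -/
def addressItems (l : Stack × ℕ) (a : ℕ) : List (Item Stack) :=
  .bit true :: .stack l.1 :: (List.replicate (l.2 + a) (.bit true) ++ [.bit false])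

section Program

variable (C : Constraint) (s₀ s₁ s₂ : Fin C.arity → Bool)

/-- The code of an application of the constraint `C` to the variables of three objects, with the
leading bit of a list entry. An object is given by the address of its first variable. -/
def gadgetItems (l₁ l₂ l₃ : Stack × ℕ) : List (Item Stack) :=
  .bit true :: (C.encode.map .bit ++ (List.finRange C.arity).flatMap fun c =>
    match kind s₀ s₁ s₂ c with
    | .const => [.bit false, .bit (s₀ c)]
    | .first => addressItems l₁ c
    | .second => addressItems l₂ c
    | .third => addressItems l₃ c)

/-- The code of the applications for an ordered pair of vertices. -/
def pairItems (adj : Bool) : List (Item Stack) :=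
  (List.finRange (multiplicity C.arity)).flatMap (fun t : Fin _ =>
    gadgetItems C s₀ s₁ s₂ (.addrI, 0) (.base, C.arity * t) (.base, C.arity * t)) ++
  if adj then gadgetItems C s₀ s₁ s₂ (.addrJ, 0) (.base, 0)
    (.base, C.arity * multiplicity C.arity) else []

/-- The number of variables of the objects of an ordered pair of vertices. -/
def pairSize (k : ℕ) : ℕ := k * (multiplicity k + 1)

/-- The program for an entry of the adjacency matrix. -/
def columnStep : StackProgram Stack :=
  .seq (.ifPop .input (emit .scratch .output (pairItems C s₀ s₁ s₂ true))
      (emit .scratch .output (pairItems C s₀ s₁ s₂ false)))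
    (pushes (List.replicate (pairSize C.arity) .base ++ List.replicate C.arity .addrJ))

/-- The program for the entries of a row of the adjacency matrix. -/
def columnLoop : StackProgram Stack := .loop .cols true (columnStep C s₀ s₁ s₂) .skip

/-- The program for a row of the adjacency matrix. -/
def rowStep : StackProgram Stack :=
  .seq (copy .order .scratch .cols) (.seq (columnLoop C s₀ s₁ s₂)
    (.seq (distribute .addrJ []) (pushes (List.replicate C.arity .addrI))))

/-- The program for the adjacency matrix. -/
def rowLoop : StackProgram Stack := .loop .rows true (rowStep C s₀ s₁ s₂) .skip

/-- The program that reads the code of a graph and pushes the code of its constraint applications on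
the output stack. -/
def graphProgram : StackProgram Stack :=
  .seq (distribute .input ([.rows, .order] ++ List.replicate C.arity .base))
    (.seq (rowLoop C s₀ s₁ s₂) (.seq (distribute .addrI []) (.seq (distribute .order [])
      (.seq (distribute .base [.total]) (.push .output false)))))

/-- The program of the reduction. -/
def reductionProgram : StackProgram Stack :=
  .seq (graphProgram C s₀ s₁ s₂) (.seq (graphProgram C s₀ s₁ s₂)
    (.seq (pour .output .result) (.seq (.push .result false) (distribute .total [.result]))))

/-- The text for an entry of the adjacency matrix. -/
def pairCode (a b c : ℕ) (adj : Bool) : List Bool :=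
  text ({ addrI := a, addrJ := b, base := c } : Contents).stacks (pairItems C s₀ s₁ s₂ adj)

/-- The text for the entries of a row of the adjacency matrix. -/
def columnCode (a : ℕ) : ℕ → ℕ → List Bool → List Bool
  | _, _, [] => []
  | b, c, x :: l => pairCode C s₀ s₁ s₂ a b c x ++
      columnCode a (b + C.arity) (c + pairSize C.arity) l

/-- The text for the rows of the adjacency matrix. -/
def rowCode : ℕ → ℕ → List (List Bool) → List Bool
  | _, _, [] => []
  | a, c, r :: l => columnCode C s₀ s₁ s₂ a 0 c r ++
      rowCode (a + C.arity) (c + pairSize C.arity * r.length) l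

theorem stack_mem_addressItems {l : Stack × ℕ} {a : ℕ} {s : Stack}
    (h : .stack s ∈ addressItems l a) : s = l.1 := by
  simpa [addressItems, List.mem_replicate] using h

theorem stack_mem_gadgetItems {l₁ l₂ l₃ : Stack × ℕ} {s : Stack}
    (h : .stack s ∈ gadgetItems C s₀ s₁ s₂ l₁ l₂ l₃) : s = l₁.1 ∨ s = l₂.1 ∨ s = l₃.1 := by
  simp only [gadgetItems, List.mem_cons, reduceCtorEq, List.mem_append, List.mem_map, and_false,
    exists_false, List.mem_flatMap, false_or] at h
  obtain ⟨c, -, h⟩ := h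
  split at h
  · simp at h
  · exact .inl (stack_mem_addressItems h)
  · exact .inr (.inl (stack_mem_addressItems h))
  · exact .inr (.inr (stack_mem_addressItems h))

theorem stack_mem_pairItems {adj : Bool} {s : Stack} (h : .stack s ∈ pairItems C s₀ s₁ s₂ adj) :
    s = .addrI ∨ s = .addrJ ∨ s = .base := by
  rcases List.mem_append.1 h with h | h
  · obtain ⟨t, -, h⟩ := List.mem_flatMap.1 h
    rcases stack_mem_gadgetItems C s₀ s₁ s₂ h with rfl | rfl | rfl <;> simp
  · split at h
    · rcases stack_mem_gadgetItems C s₀ s₁ s₂ h with rfl | rfl | rfl <;> simp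
    · simp at h

/-- A bound for the number of items in the code of the applications for an ordered pair of
vertices. -/
def itemBound : ℕ :=
  (pairItems C s₀ s₁ s₂ true).length + (pairItems C s₀ s₁ s₂ false).length

/-- A bound for the running time of an iteration of the column loop if all numbers on the stacks are
at most `M`. -/
def columnTime (M : ℕ) : ℕ :=
  itemBound C s₀ s₁ s₂ * (7 * M + 4) + pairSize C.arity + C.arity + 4

theorem columnStep_run (T : Contents) (M : ℕ) (x : Bool) (l : List Bool) (hT : T.input = x :: l)
    (hi : T.addrI ≤ M) (hj : T.addrJ ≤ M) (hb : T.base ≤ M) :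
    RunsWithin (columnStep C s₀ s₁ s₂) T.stacks
      { T with
        input := l
        output := (pairCode C s₀ s₁ s₂ T.addrI T.addrJ T.base x).reverse ++ T.output
        addrJ := T.addrJ + C.arity
        base := T.base + pairSize C.arity }.stacks (columnTime C s₀ s₁ s₂ M) := by
  have htext : text (update T.stacks .input l) (pairItems C s₀ s₁ s₂ x) =
      pairCode C s₀ s₁ s₂ T.addrI T.addrJ T.base x := by
    refine List.flatMap_congr fun y hy => ?_
    cases y with
    | bit b => rfl
    | stack s =>
      rcases stack_mem_pairItems C s₀ s₁ s₂ hy with rfl | rfl | rfl <;> rfl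
  have h₁ := emit_run (scratch := .scratch) (out := .output) (by decide) M
    (pairItems C s₀ s₁ s₂ x) (update T.stacks .input l) (fun s hs => by
      rcases stack_mem_pairItems C s₀ s₁ s₂ hs with rfl | rfl | rfl
      · exact ⟨by decide, by decide, T.addrI, hi, rfl⟩
      · exact ⟨by decide, by decide, T.addrJ, hj, rfl⟩
      · exact ⟨by decide, by decide, T.base, hb, rfl⟩) rfl
  have hlen : (pairItems C s₀ s₁ s₂ x).length ≤ itemBound C s₀ s₁ s₂ := by
    cases x
    · exact Nat.le_add_left _ _
    · exact Nat.le_add_right _ _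
  rw [htext] at h₁
  have hite : (if x then emit .scratch .output (pairItems C s₀ s₁ s₂ true)
      else emit .scratch .output (pairItems C s₀ s₁ s₂ false)) =
      emit (K := Stack) .scratch .output (pairItems C s₀ s₁ s₂ x) := by
    cases x <;> rfl
  rw [← hite] at h₁
  refine RunsWithin.congr ((RunsWithin.ifPop (S := T.stacks) (k := .input) x hT h₁).seq
    (pushes_run (List.replicate (pairSize C.arity) Stack.base ++
      List.replicate C.arity Stack.addrJ) _))
    ?_ ?_
  · funext s
    cases s <;> simp [Contents.stacks, List.count_replicate, Nat.add_comm]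
  · have := Nat.mul_le_mul_right (7 * M + 4) hlen
    simp only [List.length_append, List.length_replicate, columnTime]
    omega

/-- A bound for the running time of an iteration of the row loop for a graph of order `n` if all
numbers on the stacks are at most `M`. -/
def rowTime (n M : ℕ) : ℕ :=
  7 * n + 4 + (n * (columnTime C s₀ s₁ s₂ M + 1) + 1) + (2 * M + 2) + (C.arity + 1)

theorem columnLoop_run (M : ℕ) (l rest : List Bool) (T : Contents) (hT : T.input = l ++ rest)
    (hl : T.cols = l.length) (hi : T.addrI ≤ M) (hj : T.addrJ + C.arity * l.length ≤ M)
    (hb : T.base + pairSize C.arity * l.length ≤ M) :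
    RunsWithin (columnLoop C s₀ s₁ s₂) T.stacks
      { T with
        input := rest
        output := (columnCode C s₀ s₁ s₂ T.addrI T.addrJ T.base l).reverse ++ T.output
        addrJ := T.addrJ + C.arity * l.length
        base := T.base + pairSize C.arity * l.length
        cols := 0 }.stacks (l.length * (columnTime C s₀ s₁ s₂ M + 1) + 1) := by
  induction l generalizing T with
  | nil =>
    have h : RunsWithin (columnLoop C s₀ s₁ s₂) T.stacks T.stacks 1 :=
      .loop_nil (by simp [Contents.stacks, hl])
    refine h.congr (congrArg _ ?_) (by simp)
    cases T
    simp only [List.length_nil] at hl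
    simp_all [columnCode]
  | cons x l ih =>
    rw [List.length_cons, Nat.mul_succ] at hj hb
    have h₁ := columnStep_run C s₀ s₁ s₂ { T with cols := l.length } M x (l ++ rest) hT hi
      (by change T.addrJ ≤ M; omega) (by change T.base ≤ M; omega)
    have h₂ := ih { T with
        input := l ++ rest
        output := (pairCode C s₀ s₁ s₂ T.addrI T.addrJ T.base x).reverse ++ T.output
        addrJ := T.addrJ + C.arity
        base := T.base + pairSize C.arity
        cols := l.length } rfl rfl hi (by change T.addrJ + C.arity + _ ≤ M; omega)
      (by change T.base + pairSize C.arity + _ ≤ M; omega)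
    have hS : T.stacks .cols = true :: List.replicate l.length true := by
      simp [Contents.stacks, hl, List.replicate_succ]
    have hu : update T.stacks .cols (List.replicate l.length true) =
        { T with cols := l.length }.stacks := by
      funext s
      cases s <;> rfl
    rw [← hu] at h₁
    refine (RunsWithin.loop_true hS h₁ h₂).congr (congrArg _ ?_) ?_
    · simp only [columnCode, List.length_cons, List.reverse_append, List.append_assoc,
        Contents.mk.injEq, true_and, and_true]
      constructor <;> ring
    · rw [List.length_cons, Nat.succ_mul]
      omega

theorem rowStep_run (M : ℕ) (l rest : List Bool) (T : Contents) (hT : T.input = l ++ rest)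
    (ho : T.order = l.length) (hc : T.cols = 0) (hi : T.addrI ≤ M) (hj0 : T.addrJ = 0)
    (hj : C.arity * l.length ≤ M) (hb : T.base + pairSize C.arity * l.length ≤ M) :
    RunsWithin (rowStep C s₀ s₁ s₂) T.stacks
      { T with
        input := rest
        output := (columnCode C s₀ s₁ s₂ T.addrI 0 T.base l).reverse ++ T.output
        addrI := T.addrI + C.arity
        base := T.base + pairSize C.arity * l.length }.stacks
      (rowTime C s₀ s₁ s₂ l.length M) := by
  have h₁ := copy_run (src := .order) (scratch := .scratch) (dst := .cols) (by decide) (by decide)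
    (by decide) l.length T.stacks (by simp [Contents.stacks, ho]) rfl
  have e₁ : update T.stacks .cols (List.replicate l.length true ++ T.stacks .cols) =
      { T with cols := l.length }.stacks := by
    funext s
    cases s <;> simp [Contents.stacks, hc]
  rw [e₁] at h₁
  have h₂ := columnLoop_run C s₀ s₁ s₂ M l rest { T with cols := l.length } hT rfl hi
    (by change T.addrJ + _ ≤ M; omega) hb
  simp only [hj0, Nat.zero_add] at h₁ h₂
  have h₃ := distribute_run (k := Stack.addrJ) (l := []) (by simp) (C.arity * l.length) [] []
    (.inl ⟨rfl, rfl⟩) (Contents.stacks { T with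
      input := rest
      output := (columnCode C s₀ s₁ s₂ T.addrI 0 T.base l).reverse ++ T.output
      addrJ := C.arity * l.length
      base := T.base + pairSize C.arity * l.length
      cols := 0 }) (by simp [Contents.stacks])
  refine (h₁.seq (h₂.seq (h₃.seq (pushes_run (List.replicate C.arity Stack.addrI) _)))).congr ?_ ?_
  · funext s
    cases s <;> simp [Contents.stacks, List.count_replicate, Nat.add_comm, hj0, hc]
  · simp only [rowTime, List.length_replicate, List.length_nil]
    omega

theorem rowLoop_run (M n : ℕ) (l : List (List Bool)) (rest : List Bool) (T : Contents)
    (hln : ∀ r ∈ l, r.length = n) (hT : T.input = l.flatten ++ rest) (hl : T.rows = l.length)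
    (ho : T.order = n) (hc : T.cols = 0) (hj0 : T.addrJ = 0)
    (hi : T.addrI + C.arity * l.length ≤ M) (hj : C.arity * n ≤ M)
    (hb : T.base + pairSize C.arity * n * l.length ≤ M) :
    RunsWithin (rowLoop C s₀ s₁ s₂) T.stacks
      { T with
        input := rest
        output := (rowCode C s₀ s₁ s₂ T.addrI T.base l).reverse ++ T.output
        addrI := T.addrI + C.arity * l.length
        base := T.base + pairSize C.arity * n * l.length
        rows := 0 }.stacks (l.length * (rowTime C s₀ s₁ s₂ n M + 1) + 1) := by
  induction l generalizing T with
  | nil =>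
    have h : RunsWithin (rowLoop C s₀ s₁ s₂) T.stacks T.stacks 1 :=
      .loop_nil (by simp [Contents.stacks, hl])
    refine h.congr (congrArg _ ?_) (by simp)
    cases T
    simp only [List.length_nil] at hl
    simp_all [rowCode]
  | cons r l ih =>
    rw [List.length_cons, Nat.mul_succ] at hi hb
    obtain rfl := hln r List.mem_cons_self
    have h₁ := rowStep_run C s₀ s₁ s₂ M r (l.flatten ++ rest) { T with rows := l.length }
      (by simp [hT]) ho hc (by change T.addrI ≤ M; omega) hj0 hj
      (by change T.base + _ ≤ M; omega)
    have h₂ := ih { T with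
        input := l.flatten ++ rest
        output := (columnCode C s₀ s₁ s₂ T.addrI 0 T.base r).reverse ++ T.output
        addrI := T.addrI + C.arity
        base := T.base + pairSize C.arity * r.length
        rows := l.length } (fun r' hr' => hln r' (List.mem_cons_of_mem _ hr')) rfl rfl ho hc hj0
      (by change T.addrI + C.arity + _ ≤ M; omega)
      (by change T.base + pairSize C.arity * r.length + _ ≤ M; omega)
    have hS : T.stacks .rows = true :: List.replicate l.length true := by
      simp [Contents.stacks, hl, List.replicate_succ]
    have hu : update T.stacks .rows (List.replicate l.length true) =
        { T with rows := l.length }.stacks := by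
      funext s
      cases s <;> rfl
    rw [← hu] at h₁
    refine (RunsWithin.loop_true hS h₁ h₂).congr (congrArg _ ?_) ?_
    · simp only [rowCode, List.length_cons, List.reverse_append, List.append_assoc,
        Contents.mk.injEq, true_and, and_true]
      constructor <;> ring
    · rw [List.length_cons, Nat.succ_mul]
      omega

/-- A bound for the numbers on the stacks while a graph of order `n` is processed. -/
def addressBound (n : ℕ) : ℕ := C.arity * n + pairSize C.arity * n * n

/-- A bound for the time needed to process a graph of order `n`. -/
def graphTime (n : ℕ) : ℕ :=
  n * (C.arity + 4) + 2 + (n * (rowTime C s₀ s₁ s₂ n (addressBound C n) + 1) + 1) +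
    (C.arity * n * 2 + 2) + (n * 2 + 2) + (addressBound C n * 3 + 2) + 1

/-- The text for a graph, without the final bit, from the rows of its adjacency matrix. -/
def graphCode (l : List (List Bool)) : List Bool :=
  rowCode C s₀ s₁ s₂ 0 (C.arity * l.length) l

theorem graphProgram_run (l : List (List Bool)) (hl : ∀ r ∈ l, r.length = l.length)
    (rest out : List Bool) (a : ℕ) :
    RunsWithin (graphProgram C s₀ s₁ s₂)
      ({ input := encodeNat l.length ++ (l.flatten ++ rest), output := out, total := a } :
        Contents).stacks
      ({ input := rest, output := (graphCode C s₀ s₁ s₂ l ++ [false]).reverse ++ out,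
         total := a + addressBound C l.length } : Contents).stacks
      (graphTime C s₀ s₁ s₂ l.length) := by
  have h₁ := distribute_run (k := Stack.input)
    (l := [.rows, .order] ++ List.replicate C.arity Stack.base) (by simp [List.mem_replicate])
    l.length (l.flatten ++ rest) (false :: (l.flatten ++ rest)) (.inr rfl)
    (({ input := encodeNat l.length ++ (l.flatten ++ rest), output := out, total := a } :
        Contents).stacks) (by simp [Contents.stacks, encodeNat])
  have e₁ : (fun i => if i = Stack.input then l.flatten ++ rest else
      List.replicate (l.length * ([Stack.rows, Stack.order] ++ List.replicate C.arity Stack.base).count i)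
        true ++ ({ input := encodeNat l.length ++ (l.flatten ++ rest), output := out, total := a } :
        Contents).stacks i) =
      ({ input := l.flatten ++ rest, output := out, base := C.arity * l.length, rows := l.length,
         order := l.length, total := a } : Contents).stacks := by
    funext s
    cases s <;> simp [Contents.stacks, List.count_replicate, Nat.mul_comm]
  rw [e₁] at h₁
  have h₂ := rowLoop_run C s₀ s₁ s₂ (addressBound C l.length) l.length l rest
    { input := l.flatten ++ rest, output := out, base := C.arity * l.length, rows := l.length,
      order := l.length, total := a } hl rfl rfl rfl rfl rfl
    (by simp only [addressBound]; omega) (by simp only [addressBound]; omega)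
    (by simp only [addressBound]; omega)
  simp only [Nat.zero_add] at h₂
  have h₃ := distribute_run (k := Stack.addrI) (l := []) (by simp) (C.arity * l.length) [] []
    (.inl ⟨rfl, rfl⟩) (Contents.stacks {
      input := rest
      output := (graphCode C s₀ s₁ s₂ l).reverse ++ out
      addrI := C.arity * l.length
      base := addressBound C l.length
      order := l.length
      total := a }) (by simp [Contents.stacks])
  have e₃ : (fun i => if i = Stack.addrI then [] else
      List.replicate (C.arity * l.length * ([] : List Stack).count i) true ++ Contents.stacks {
        input := rest
        output := (graphCode C s₀ s₁ s₂ l).reverse ++ out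
        addrI := C.arity * l.length
        base := addressBound C l.length
        order := l.length
        total := a } i) =
      Contents.stacks {
        input := rest
        output := (graphCode C s₀ s₁ s₂ l).reverse ++ out
        base := addressBound C l.length
        order := l.length
        total := a } := by
    funext s
    cases s <;> simp [Contents.stacks]
  rw [e₃] at h₃
  have h₄ := distribute_run (k := Stack.order) (l := []) (by simp) l.length [] []
    (.inl ⟨rfl, rfl⟩) (Contents.stacks {
      input := rest
      output := (graphCode C s₀ s₁ s₂ l).reverse ++ out
      base := addressBound C l.length
      order := l.length
      total := a }) (by simp [Contents.stacks])
  have e₄ : (fun i => if i = Stack.order then [] else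
      List.replicate (l.length * ([] : List Stack).count i) true ++ Contents.stacks {
        input := rest
        output := (graphCode C s₀ s₁ s₂ l).reverse ++ out
        base := addressBound C l.length
        order := l.length
        total := a } i) =
      Contents.stacks {
        input := rest
        output := (graphCode C s₀ s₁ s₂ l).reverse ++ out
        base := addressBound C l.length
        total := a } := by
    funext s
    cases s <;> simp [Contents.stacks]
  rw [e₄] at h₄
  have h₅ := distribute_run (k := Stack.base) (l := [.total]) (by simp) (addressBound C l.length)
    [] [] (.inl ⟨rfl, rfl⟩) (Contents.stacks {
      input := rest
      output := (graphCode C s₀ s₁ s₂ l).reverse ++ out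
      base := addressBound C l.length
      total := a }) (by simp [Contents.stacks])
  have h₆ := fun S => (⟨1, le_rfl, .push Stack.output false S⟩ : RunsWithin _ S _ 1)
  refine (h₁.seq (h₂.seq (h₃.seq (h₄.seq (h₅.seq (h₆ _)))))).congr ?_ ?_
  · funext s
    cases s <;> simp [Contents.stacks, Nat.add_comm]
  · simp only [graphTime, List.length_append, List.length_cons, List.length_nil,
      List.length_replicate]
    ring_nf
    omega

/-- A bound for the running time of the program of the reduction on a code of length `n`. -/
def totalTime (n : ℕ) : ℕ := 12 * graphTime C s₀ s₁ s₂ n + 5 * n + 10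

theorem reductionProgram_run (l l' : List (List Bool)) (hl : ∀ r ∈ l, r.length = l.length)
    (hl' : ∀ r ∈ l', r.length = l'.length) (n : ℕ)
    (hn : (encodeNat l.length ++ (l.flatten ++ (encodeNat l'.length ++ l'.flatten))).length ≤ n)
    (ht : graphTime C s₀ s₁ s₂ l.length ≤ graphTime C s₀ s₁ s₂ n)
    (ht' : graphTime C s₀ s₁ s₂ l'.length ≤ graphTime C s₀ s₁ s₂ n) :
    RunsWithin (reductionProgram C s₀ s₁ s₂)
      (only .input (encodeNat l.length ++ (l.flatten ++ (encodeNat l'.length ++ l'.flatten))))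
      (only .result (encodeNat (addressBound C l.length + addressBound C l'.length) ++
        ((graphCode C s₀ s₁ s₂ l ++ [false]) ++ (graphCode C s₀ s₁ s₂ l' ++ [false]))))
      (totalTime C s₀ s₁ s₂ n) := by
  have h₁ := graphProgram_run C s₀ s₁ s₂ l hl (encodeNat l'.length ++ l'.flatten) [] 0
  have h₂ := graphProgram_run C s₀ s₁ s₂ l' hl' [] ((graphCode C s₀ s₁ s₂ l ++ [false]).reverse)
    (addressBound C l.length)
  simp only [List.append_nil, Nat.zero_add] at h₁ h₂
  have e : (only .input (encodeNat l.length ++ (l.flatten ++ (encodeNat l'.length ++ l'.flatten)))) =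
      ({ input := encodeNat l.length ++ (l.flatten ++ (encodeNat l'.length ++ l'.flatten)) } :
        Contents).stacks := by
    funext s
    cases s <;> rfl
  rw [e]
  obtain ⟨t₁, ht₁, h₁⟩ := h₁
  obtain ⟨t₂, ht₂, h₂⟩ := h₂
  -- no stack can be longer than the input and the number of steps together
  have hsize := (h₁.seq h₂).length_le
  have hin : ∑ s, (({ input := encodeNat l.length ++ (l.flatten ++ (encodeNat l'.length ++
      l'.flatten)) } : Contents).stacks s).length ≤ n := by
    rw [Finset.sum_eq_single Stack.input]
    · exact hn
    · intro s _ hs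
      cases s <;> first | rfl | exact absurd rfl hs
    · exact fun h => absurd (Finset.mem_univ _) h
  obtain ⟨S, hS⟩ : ∃ S, S = Contents.stacks {
      output := (graphCode C s₀ s₁ s₂ l' ++ [false]).reverse ++
        (graphCode C s₀ s₁ s₂ l ++ [false]).reverse
      total := addressBound C l.length + addressBound C l'.length } := ⟨_, rfl⟩
  rw [← hS] at hsize h₂
  have hlen : ∀ s, (S s).length ≤ n + (t₁ + t₂) := fun s =>
    (Finset.single_le_sum (f := fun s => (S s).length) (fun _ _ => Nat.zero_le _)
      (Finset.mem_univ s)).trans (hsize.trans (Nat.add_le_add_right hin _))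
  have hout := hlen .output
  have htot := hlen .total
  have h₃ := pour_run (src := Stack.output) (dst := .result) (by decide) _ S rfl
  have h₄ : ∀ S, RunsWithin (.push Stack.result false) S _ 1 := fun S =>
    ⟨1, le_rfl, .push Stack.result false S⟩
  have h₅ := distribute_run (k := Stack.total) (l := [.result]) (by simp)
    (addressBound C l.length + addressBound C l'.length) [] [] (.inl ⟨rfl, rfl⟩)
    (update (update (update S .output []) .result ((S .output).reverse ++ S .result)) .result
      (false :: update (update S .output []) .result ((S .output).reverse ++ S .result) .result))
    (by simp [hS, Contents.stacks])
  have htot' : (S .total).length = addressBound C l.length + addressBound C l'.length := by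
    simp [hS, Contents.stacks]
  refine RunsWithin.congr (RunsWithin.seq ⟨t₁, le_rfl, h₁⟩ (RunsWithin.seq ⟨t₂, le_rfl, h₂⟩
    (h₃.seq (RunsWithin.seq (h₄ _) h₅)))) ?_ ?_
  · funext s
    cases s <;> simp [hS, Contents.stacks, only, encodeNat]
  · simp only [totalTime, List.length_cons, List.length_nil]
    omega

end Program

end BoolIso

namespace BoolIso

/-! ### The program computes the reduction -/

open StackProgram Function

section Code

variable {𝒞 : Finset Constraint} {C : Constraint} (hC : C ∈ 𝒞) (s₀ s₁ s₂ : Fin C.arity → Bool)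

theorem text_addressItems {S : Stack → List Bool} {s : Stack} {m : ℕ}
    (hs : S s = List.replicate m true) (d a : ℕ) :
    text S (addressItems (s, d) a) = true :: encodeNat (m + (d + a)) := by
  have h : ∀ q, text S (List.replicate q (.bit true)) = List.replicate q true := fun q => by
    induction q with
    | zero => rfl
    | succ q ih => exact congrArg (true :: ·) ih
  change true :: (S s ++ text S (List.replicate (d + a) (.bit true) ++ [.bit false])) = _
  rw [text_append, h, hs, encodeNat, ← List.append_assoc, ← List.replicate_add]
  rfl

theorem text_gadgetItems {n N : ℕ} (ι : Obj C.arity n × Fin C.arity → Fin N)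
    {o₁ o₂ o₃ : Obj C.arity n} {l₁ l₂ l₃ : Stack × ℕ} {S : Stack → List Bool}
    (h₁ : ∀ c : Fin C.arity, text S (addressItems l₁ c) = true :: encodeNat (ι (o₁, c)))
    (h₂ : ∀ c : Fin C.arity, text S (addressItems l₂ c) = true :: encodeNat (ι (o₂, c)))
    (h₃ : ∀ c : Fin C.arity, text S (addressItems l₃ c) = true :: encodeNat (ι (o₃, c))) :
    text S (gadgetItems C s₀ s₁ s₂ l₁ l₂ l₃) =
      true :: (gadgetApplication hC s₀ s₁ s₂ ι o₁ o₂ o₃).encode := by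
  have hbits : text S (C.encode.map .bit) = C.encode := by
    simp [text, List.flatMap_map]
  refine congrArg (true :: ·) ?_
  change text S (_ ++ _) = C.encode ++ encodeTuple Arg.encode _
  rw [text_append, hbits, encodeTuple, List.ofFn_eq_map, List.flatMap_map, text,
    List.flatMap_assoc]
  congr 1
  refine List.flatMap_congr fun (c : Fin C.arity) _ => ?_
  cases hc : kind s₀ s₁ s₂ c <;> simp only [gadgetApplication, hc]
  · rfl
  · exact h₁ c
  · exact h₂ c
  · exact h₃ c

/-- The address of the first vertex, the address of the second vertex and the address of the first
pairing object determine all variable numbers that occur for an ordered pair of vertices. -/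
theorem flatMap_pairApplications {n N : ℕ} (hN : varCount C.arity n ≤ N) (adj : Bool)
    (i j : Fin n) :
    (pairApplications hC s₀ s₁ s₂ (varIndex hN) adj i j).flatMap (fun A => true :: A.encode) =
      pairCode C s₀ s₁ s₂ (C.arity * i) (C.arity * j)
        (C.arity * n + pairSize C.arity * (j + n * i)) adj := by
  have hv : ∀ (i : Fin n) (S : Stack → List Bool) (s : Stack),
      S s = List.replicate (C.arity * i) true → ∀ c : Fin C.arity,
      text S (addressItems (s, 0) c) = true :: encodeNat (varIndex hN (.vertex i, c)) := by
    intro i S s hs c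
    rw [text_addressItems hs, Nat.zero_add]
    rfl
  rw [pairCode, pairItems, pairApplications, text_append, List.flatMap_append, List.flatMap_map,
    text, List.flatMap_assoc]
  congr 1
  · refine List.flatMap_congr fun t _ => Eq.symm ?_
    have hp : ∀ c : Fin C.arity, text (Contents.stacks {
        addrI := C.arity * i
        addrJ := C.arity * j
        base := C.arity * n + pairSize C.arity * (j + n * i) })
          (addressItems (.base, C.arity * t) c) =
        true :: encodeNat (varIndex hN (.pair i j t, c)) := fun c => by
      rw [text_addressItems rfl]
      congr 2
      simp only [varIndex, Obj.index, pairSize]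
      ring
    exact text_gadgetItems hC s₀ s₁ s₂ _ (hv i _ _ rfl) hp hp
  · cases adj with
    | false => rfl
    | true =>
      rw [if_pos rfl, if_pos rfl, List.flatMap_singleton]
      refine (text_gadgetItems hC s₀ s₁ s₂ _ (hv j _ _ rfl) (fun c => ?_) fun c => ?_).symm
      all_goals
        rw [text_addressItems rfl]
        congr 2
        simp only [varIndex, Obj.index, pairSize, Fin.val_zero]
        ring

theorem columnCode_ofFn (a b c q : ℕ) (g : Fin q → Bool) :
    columnCode C s₀ s₁ s₂ a b c (List.ofFn g) = (List.finRange q).flatMap fun j : Fin q =>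
      pairCode C s₀ s₁ s₂ a (b + C.arity * j) (c + pairSize C.arity * j) (g j) := by
  induction q generalizing b c with
  | zero => simp [columnCode]
  | succ q ih =>
    rw [List.ofFn_succ, columnCode, ih, List.finRange_succ, List.flatMap_cons, List.flatMap_map]
    congr 1
    refine List.flatMap_congr fun j _ => ?_
    congr 1 <;> rw [Fin.val_succ] <;> ring

theorem rowCode_ofFn (a c n q : ℕ) (g : Fin q → Fin n → Bool) :
    rowCode C s₀ s₁ s₂ a c (List.ofFn fun i => List.ofFn (g i)) =
      (List.finRange q).flatMap fun i : Fin q => columnCode C s₀ s₁ s₂ (a + C.arity * i) 0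
        (c + pairSize C.arity * n * i) (List.ofFn (g i)) := by
  induction q generalizing a c with
  | zero => simp [rowCode]
  | succ q ih =>
    rw [List.ofFn_succ, rowCode, ih, List.finRange_succ, List.flatMap_cons, List.flatMap_map,
      List.length_ofFn]
    congr 1
    refine List.flatMap_congr fun j _ => ?_
    congr 1 <;> rw [Fin.val_succ] <;> ring

open Classical in
/-- The rows of the adjacency matrix of a graph. -/
noncomputable def Graph.rows (G : Graph) : List (List Bool) :=
  List.ofFn fun v => List.ofFn fun w => decide (G.graph.Adj v w)

theorem Graph.length_rows (G : Graph) : G.rows.length = G.order := List.length_ofFn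

theorem Graph.length_of_mem_rows (G : Graph) : ∀ r ∈ G.rows, r.length = G.rows.length := by
  intro r hr
  obtain ⟨v, rfl⟩ := (List.mem_ofFn' _ _).1 hr
  rw [G.length_rows, List.length_ofFn]

theorem Graph.encode_eq (G : Graph) : G.encode = encodeNat G.rows.length ++ G.rows.flatten := by
  have h : ∀ {q : ℕ} (v : Fin q → Bool), encodeTuple encodeBit v = List.ofFn v := fun v => by
    simp only [encodeTuple]
    exact List.flatMap_singleton' _
  rw [G.length_rows, Graph.encode, encodeTuple, Graph.rows, List.flatMap_def, List.map_ofFn]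
  congr 3
  funext v
  exact h _

/-- The program produces the code of the constraint applications of a graph. -/
theorem encodeList_graphApplications (G : Graph) {N : ℕ} (hN : varCount C.arity G.order ≤ N) :
    encodeList Application.encode (graphApplications hC s₀ s₁ s₂ (varIndex hN) G.graph) =
      graphCode C s₀ s₁ s₂ G.rows ++ [false] := by
  rw [encodeList, graphApplications, List.flatMap_assoc, graphCode, G.length_rows, Graph.rows,
    rowCode_ofFn]
  congr 1
  refine List.flatMap_congr fun i _ => ?_
  rw [List.flatMap_assoc, columnCode_ofFn]
  refine List.flatMap_congr fun j _ => ?_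
  rw [flatMap_pairApplications]
  congr 1 <;> ring

theorem addressBound_eq_varCount (n : ℕ) : addressBound C n = varCount C.arity n := by
  simp only [addressBound, varCount, pairSize]
  ring

theorem encode_reduction (p : Graph × Graph) :
    (reduction hC s₀ s₁ s₂ p).encode =
      encodeNat (addressBound C p.1.rows.length + addressBound C p.2.rows.length) ++
        ((graphCode C s₀ s₁ s₂ p.1.rows ++ [false]) ++
          (graphCode C s₀ s₁ s₂ p.2.rows ++ [false])) := by
  rw [← encodeList_graphApplications hC s₀ s₁ s₂ p.1 (Nat.le_add_right _ _),
    ← encodeList_graphApplications hC s₀ s₁ s₂ p.2 (Nat.le_add_left _ _),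
    addressBound_eq_varCount, addressBound_eq_varCount, p.1.length_rows, p.2.length_rows]
  rfl

end Code

section Time

variable (D : Constraint) (s₀ s₁ s₂ : Fin D.arity → Bool)

theorem graphTime_mono : Monotone (graphTime D s₀ s₁ s₂) := by
  intro a b h
  simp only [graphTime, rowTime, columnTime, addressBound]
  gcongr

open Polynomial in
/-- The time bound, including a last step in which the machine halts, is a polynomial. -/
theorem exists_polynomial_totalTime :
    ∃ P : Polynomial ℕ, ∀ n, P.eval n = totalTime D s₀ s₁ s₂ n + 1 := by
  let k : Polynomial ℕ := C (D.arity)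
  let q : Polynomial ℕ := C (pairSize D.arity)
  let M : Polynomial ℕ := k * X + q * X * X
  let T : Polynomial ℕ := C (itemBound D s₀ s₁ s₂) * (7 * M + 4) + q + k + 4
  let R : Polynomial ℕ := 7 * X + 4 + (X * (T + 1) + 1) + (2 * M + 2) + (k + 1)
  let G : Polynomial ℕ := X * (k + 4) + 2 + (X * (R + 1) + 1) + (k * X * 2 + 2) + (X * 2 + 2) +
    (M * 3 + 2) + 1
  refine ⟨12 * G + 5 * X + 10 + 1, fun n => ?_⟩
  simp [G, R, T, M, q, k, totalTime, graphTime, rowTime, columnTime, addressBound]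

end Time

/-- The reduction is computed by its program in polynomial time. -/
theorem reduction_computableInPolyTime {𝒞 : Finset Constraint} {C : Constraint} (hC : C ∈ 𝒞)
    (s₀ s₁ s₂ : Fin C.arity → Bool) :
    Nonempty (Turing.TM2ComputableInPolyTime GI.encode (ISOc 𝒞).encode
      (reduction hC s₀ s₁ s₂)) := by
  obtain ⟨P, hP⟩ := exists_polynomial_totalTime C s₀ s₁ s₂
  refine computableInPolyTime _ _ _ (reductionProgram C s₀ s₁ s₂) .input .result P fun p => ?_
  have hcode : GI.encode p = encodeNat p.1.rows.length ++ (p.1.rows.flatten ++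
      (encodeNat p.2.rows.length ++ p.2.rows.flatten)) := by
    change p.1.encode ++ p.2.encode = _
    rw [p.1.encode_eq, p.2.encode_eq, List.append_assoc]
  have hout : (ISOc 𝒞).encode (reduction hC s₀ s₁ s₂ p) = _ := encode_reduction hC s₀ s₁ s₂ p
  have hlen := congrArg List.length hcode
  simp only [List.length_append, encodeNat, List.length_replicate] at hlen
  obtain ⟨t, ht, h⟩ := reductionProgram_run C s₀ s₁ s₂ p.1.rows p.2.rows p.1.length_of_mem_rows
    p.2.length_of_mem_rows (GI.encode p).length (by rw [hcode])
    (graphTime_mono C s₀ s₁ s₂ (by omega)) (graphTime_mono C s₀ s₁ s₂ (by omega))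
  refine ⟨t, ?_, ?_⟩
  · rw [hP]
    exact Nat.succ_le_succ ht
  · rw [hcode, hout]
    exact h

end BoolIso

theorem theorem3p9 (𝒞 : Finset BoolIso.Constraint) (h𝒞 : ¬ BoolIso.IsAffine 𝒞) :
    BoolIso.PolyTimeManyOneReducible BoolIso.GI (BoolIso.ISOc 𝒞) := by
  obtain ⟨C, hC, hC'⟩ : ∃ C ∈ 𝒞, ¬ C.IsAffine := by
    by_contra! h
    exact h𝒞 h
  obtain ⟨s₀, s₁, s₂, h⟩ := BoolIso.exists_threePointFace C hC'
  exact ⟨BoolIso.reduction hC s₀ s₁ s₂, BoolIso.reduction_computableInPolyTime hC s₀ s₁ s₂,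
    BoolIso.reduction_correct hC h⟩
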